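/- **Setting.** Let $M$ be a compact Lie group (without boundary; e.g. $M=G^{\times n}$ with $G$ compact) with Haar measure, and let $\phi=(\phi^c)_c$, $\phi^c:M\times\mathbb R\to\mathbb C$, be finitely many smooth fields, possibly required to satisfy $\phi^c(k(g),\varphi)=\phi^c(g,\varphi)$ for all $k$ in a given set of maps $k:M\to M$ (gauge invariance, simplicity constraints). Let $L^{loc}$ be a smooth real function of $(g,\varphi)$, of the field values and of the first derivatives of the fields at $(g,\varphi)$. Let there be finitely many interactions: for each $i$ a compact Lie group $\Omega_i$ with Haar measure, smooth maps $f_{i,j}:\Omega_i\to M$ ($1\le j\le n_i$) and a smooth real function $L^{int}_i$ of $(x,\varphi)\in\Omega_i\times\mathbb R$ and of the values $\phi(f_{i,j}(x),\varphi)$, all taken at the same $\varphi$, and of no derivatives. The action is $$S=\int_{M\times\mathbb R}L^{loc}+\sum_i\int_{\Omega_i\times\mathbb R}L_i^{int},\qquad S|_\varphi=\int_M L^{loc}|_\varphi+\sum_i\int_{\Omega_i}L_i^{int}|_\varphi .$$ A field is *on shell* if it lies in the field space and for all $a<b$ the action over $a\le\varphi\le b$ is stationary under all variations in the field space that vanish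 for $\varphi\notin(a,b)$. Consider a smooth one-parameter group of point transformations $(g,\varphi,u)\mapsto(C_\epsilon(g,\varphi,u),\rho_\epsilon(\varphi),Q_\epsilon(g,\varphi,u))$ of $M\times\mathbb R\times\mathbb C^{\{c\}}$. It acts on fields by moving their graphs: wherever the transformed field $\tilde\phi$ is defined, $\tilde\phi(C_\epsilon(g,\varphi,\phi(g,\varphi)),\rho_\epsilon(\varphi))=Q_\epsilon(g,\varphi,\phi(g,\varphi))$. It is a *symmetry* if it preserves the field space, it lifts for each $i$ to a smooth one-parameter group of transformations of the bundle over $\Omega_i\times\mathbb R$ (the pullback of $n_i$ copies of the field bundle), and each functional in the action sum separately satisfies $S_{C(\Omega')}[\tilde\phi]=S_{\Omega'}[\phi]$ whenever $J\subseteq\mathbb R$ is open, $\tilde\phi$ is a transform of $\phi$ over $M\times J$ (both in the field space), and $\Omega'$ is a compact subset of $M\times J$, respectively of $\Omega_i\times J$. Its generator has components $X_M=\partial_\epsilon|_0C_\epsilon$, $X_{\mathbb R}^\varphi=\partial_\epsilon|_0\rho_\epsilon(\varphi)$, $X_V=\partial_\epsilon|_0Q_\epsilon$, taken at the value of the field,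 and its characteristic is $X_Q^c=X_V^c-X_M(\phi^c)-X_{\mathbb R}^\varphi\,\partial_\varphi\phi^c$. Let $\Pi^c=\partial_{\partial_\varphi\phi^c}L^{loc}$ and $\bar\Pi^c=\partial_{\partial_\varphi\bar\phi^c}L^{loc}$ (Wirtinger derivatives along the field), and define $$Q(\varphi)=S|_\varphi\,X^\varphi_{\mathbb R}+\int_M\sum_c\big(\Pi^cX_Q^c+\bar\Pi^c\bar X_Q^c\big).$$ **Claims.** 1. For every symmetry and every on-shell field, $Q$ is differentiable and $\partial_\varphi Q(\varphi)=0$ for all $\varphi$. 2. For the $U(1)$ transformations $\phi^c\mapsto e^{i\epsilon\theta^c}\phi^c$, $\theta^c\in\mathbb R$, one has $X_Q^c=i\theta^c\phi^c$ and, for every smooth field, $$Q(\varphi)=i\sum_c\theta^c\int_M\big(\phi^c\,\Pi^c-\bar\phi^c\,\bar\Pi^c\big).$$ 3. For transformations of $M$ alone ($X_V=0$, $X_{\mathbb R}=0$), in particular for $M\cong SU(2)^{n}$ and $g_i\mapsto e^{\epsilon A_i}g_ie^{\epsilon B_i}$ with $A_i,B_i\in\mathfrak{su}(2)$, one has $X_Q^c=-X_M(\phi^c)$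 and, for every smooth field, $$Q(\varphi)=-\int_M\sum_c\Pi^c\,X_M(\phi^c)-\int_M\sum_c\bar\Pi^c\,X_M(\bar\phi^c).$$ 4. If no Lagrangian depends explicitly on $\varphi$, the translations $\varphi\mapsto\varphi+\mu$ are a symmetry. In any case their charge is, for every smooth field, $$Q(\varphi)=-\int_M\sum_c\big(\Pi^c\,\partial_\varphi\phi^c+\bar\Pi^c\,\partial_\varphi\bar\phi^c\big)+S|_\varphi .$$ Up to sign this is the Legendre transform (a Hamiltonian) of $S|_\varphi$ viewed as a Lagrangian in the slice field $q=\phi(\cdot,\varphi)$ and the velocity $v=\partial_\varphi\phi(\cdot,\varphi)$: the derivative of $S|_\varphi$ with respect to the velocity, in the direction of any continuous $w=(w^c)_c$, $w^c:M\to\mathbb C$, exists and equals $\int_M\sum_c(\Pi^cw^c+\bar\Pi^c\bar w^c)$. -/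

import Mathlib

open scoped Manifold ContDiff
open MeasureTheory Set

universe u w

noncomputable section

/-- A compact (finite-dimensional, boundaryless) Lie group together with a Haar measure. The base
manifolds of group field theory are of this kind: finite products of copies of a group `G`. -/
structure HaarLieGroup where
  carrier : Type u
  vec : Type u
  model : Type u
  [normedVec : NormedAddCommGroup vec]
  [spaceVec : NormedSpace ℝ vec]
  [finVec : FiniteDimensional ℝ vec]
  [topModel : TopologicalSpace model]
  I : ModelWithCorners ℝ vec model
  [boundaryless : I.Boundaryless]
  [group : Group carrier]
  [top : TopologicalSpace carrier]
  [charted : ChartedSpace model carrier]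
  [lie : LieGroup I ∞ carrier]
  [compact : CompactSpace carrier]
  [t2 : T2Space carrier]
  [secondCountable : SecondCountableTopology carrier]
  [measurable : MeasurableSpace carrier]
  [borel : BorelSpace carrier]
  haar : Measure carrier
  [isHaar : haar.IsHaarMeasure]

namespace HaarLieGroup

instance : CoeSort HaarLieGroup.{u} (Type u) := ⟨HaarLieGroup.carrier⟩

attribute [instance] normedVec spaceVec finVec topModel boundaryless group top charted lie compact
  t2 secondCountable measurable borel isHaar

end HaarLieGroup

namespace GFT

/-- The fibre of the field bundle: one complex value for each colour. -/
abbrev Fib (C : Type w) : Type w := C → ℂ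

/-- A multiplet of (not necessarily smooth) fields `φ c (g, t)` on `M × ℝ`; `t` is the value of
the matter clock variable. -/
abbrev Field (C : Type w) (M : HaarLieGroup.{u}) : Type _ := C → M → ℝ → ℂ

/-- Fibre coordinates of the first jet bundle over `M × ℝ`, together with the clock variable:
`(t, u, p, v)` where `u` are the field values, `p` the derivatives of the fields along `M` (a linear
form on the Lie algebra for each colour, by left trivialisation), `v` the clock derivatives. -/
abbrev Jet (C : Type w) (M : HaarLieGroup.{u}) : Type _ :=
  ℝ × Fib C × (C → (M.vec →L[ℝ] ℂ)) × Fib C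

variable {C : Type w} [Fintype C] {M : HaarLieGroup.{u}}

/-- A non-local interaction term that is local in the clock variable. Its base manifold is
`Ω × ℝ`; the map `legs` from `Ω` to `M ^ arity` is the combinatorial pattern. The Lagrangian depends
on the point of `Ω × ℝ` and on the field values at the points `(legs j x, t)`, `j < arity`, all at the
same `t`, and on no derivatives of the fields. -/
structure Interaction (C : Type w) [Fintype C] (M : HaarLieGroup.{u}) where
  Ω : HaarLieGroup.{u}
  arity : ℕ
  legs : Fin arity → Ω → M
  legs_smooth : ∀ j, ContMDiff Ω.I M.I ∞ (legs j)
  lagrangian : Ω → ℝ × (Fin arity → Fib C) → ℝ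
  lagrangian_smooth : ContMDiff (Ω.I.prod 𝓘(ℝ, ℝ × (Fin arity → Fib C))) 𝓘(ℝ, ℝ) ∞
    (fun z : Ω × (ℝ × (Fin arity → Fib C)) => lagrangian z.1 z.2)

/-- A group field theory with fields on `M × ℝ`: a local first-order Lagrangian, finitely many
interaction terms, and a set of maps of `M` under which the fields are required to be invariant (gauge
invariance, simplicity constraints; empty if no constraint is imposed). -/
structure Model (C : Type w) [Fintype C] (M : HaarLieGroup.{u}) where
  locLagrangian : M → Jet C M → ℝ
  locLagrangian_smooth : ContMDiff (M.I.prod 𝓘(ℝ, Jet C M)) 𝓘(ℝ, ℝ) ∞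
    (fun z : M × Jet C M => locLagrangian z.1 z.2)
  numInter : ℕ
  inter : Fin numInter → Interaction C M
  constraints : Set (M → M)

/-- The value of the field multiplet at a point of `M × ℝ`. -/
def val (φ : Field C M) (g : M) (t : ℝ) : Fib C := fun c => φ c g t

/-- The derivative `∂_t φ` with respect to the clock variable. -/
def clockDeriv (φ : Field C M) (g : M) (t : ℝ) : Fib C := fun c => deriv (fun s => φ c g s) t

/-- Left-trivialised differential of a function on the group: the derivative of `h ↦ q (g h)` at the
identity, a linear form on the Lie algebra. -/
def leftGrad (q : M → ℂ) (g : M) : M.vec →L[ℝ] ℂ :=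
  mfderiv M.I 𝓘(ℝ, ℂ) (fun h : M => q (g * h)) 1

/-- The jet with values and group derivatives taken from `q`, and clock velocity `v`. -/
def sliceJet (t : ℝ) (q v : C → M → ℂ) (g : M) : Jet C M :=
  (t, fun c => q c g, fun c => leftGrad (q c) g, fun c => v c g)

/-- The restriction of the fields to fixed `t`, and of their clock derivatives. -/
def slice (φ : Field C M) (t : ℝ) : C → M → ℂ := fun c g => φ c g t

def sliceVel (φ : Field C M) (t : ℝ) : C → M → ℂ := fun c g => clockDeriv φ g t c

/-- The first jet of the field multiplet. -/
def jet (φ : Field C M) (g : M) (t : ℝ) : Jet C M := sliceJet t (slice φ t) (sliceVel φ t) g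

def Smooth (φ : Field C M) : Prop :=
  ∀ c, ContMDiff (M.I.prod 𝓘(ℝ, ℝ)) 𝓘(ℝ, ℂ) ∞ (fun p : M × ℝ => φ c p.1 p.2)

namespace Interaction

variable (T : Interaction C M)

/-- The values of the fields at the legs of the interaction. -/
def legVals (φ : Field C M) (x : T.Ω) (t : ℝ) : Fin T.arity → Fib C :=
  fun j => val φ (T.legs j x) t

/-- The interaction functional over a subdomain of `Ω × ℝ`. -/
def action (φ : Field C M) (A : Set (T.Ω × ℝ)) : ℝ :=
  ∫ p in A, T.lagrangian p.1 (p.2, T.legVals φ p.1 p.2) ∂(T.Ω.haar.prod volume)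

end Interaction

namespace Model

variable (S : Model C M)

/-- The field space: smooth fields that satisfy the constraints. -/
def Admissible (φ : Field C M) : Prop :=
  Smooth φ ∧ ∀ k ∈ S.constraints, ∀ c g t, φ c (k g) t = φ c g t

/-- The local functional over a subdomain of `M × ℝ`. -/
def locAction (φ : Field C M) (A : Set (M × ℝ)) : ℝ :=
  ∫ p in A, S.locLagrangian p.1 (jet φ p.1 p.2) ∂(M.haar.prod volume)

/-- The full action over the slab `a ≤ t ≤ b`. -/
def action (φ : Field C M) (a b : ℝ) : ℝ :=
  S.locAction φ (univ ×ˢ Icc a b) + ∑ i, (S.inter i).action φ (univ ×ˢ Icc a b)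

/-- Solutions of the equations of motion: the action is stationary under all admissible variations
that are supported between two values of the clock variable. -/
def OnShell (φ : Field C M) : Prop :=
  S.Admissible φ ∧ ∀ a b : ℝ, a < b → ∀ η : Field C M, S.Admissible η →
    (∀ c g, ∀ t ∉ Ioo a b, η c g t = 0) →
    HasDerivAt (fun ε : ℝ => S.action (fun c g t => φ c g t + (ε : ℂ) * η c g t) a b) 0 0

/-- The Lagrangian on a slice of fixed `t`, as a functional of the field configuration `q` on `M`
and of the velocity `v`: integral of the local Lagrangian over `M` plus integrals of the interaction
Lagrangians over their domains. -/
def sliceLagrangian (t : ℝ) (q v : C → M → ℂ) : ℝ :=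
  (∫ g, S.locLagrangian g (sliceJet t q v g) ∂M.haar) +
    ∑ i, ∫ x, (S.inter i).lagrangian x (t, fun j c => q c ((S.inter i).legs j x)) ∂(S.inter i).Ω.haar

/-- `S|_t`, the action at the fixed value `t` of the clock variable. -/
def sliceAction (φ : Field C M) (t : ℝ) : ℝ := S.sliceLagrangian t (slice φ t) (sliceVel φ t)

open Classical in
/-- Real directional derivative of the local Lagrangian in the clock velocity of colour `c`, in the
direction `z : ℂ`. -/
def velDeriv (c : C) (g : M) (J : Jet C M) (z : ℂ) : ℝ :=
  fderiv ℝ (fun v : Fib C => S.locLagrangian g (J.1, J.2.1, J.2.2.1, v)) J.2.2.2 (Pi.single c z)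

/-- The Wirtinger derivative `∂L/∂(∂_t φ^c)` of the local Lagrangian. -/
def momentumJet (c : C) (g : M) (J : Jet C M) : ℂ :=
  ((S.velDeriv c g J 1 : ℂ) - Complex.I * (S.velDeriv c g J Complex.I : ℂ)) / 2

/-- The Wirtinger derivative `∂L/∂(∂_t φ̄^c)` of the local Lagrangian. -/
def momentumBarJet (c : C) (g : M) (J : Jet C M) : ℂ :=
  ((S.velDeriv c g J 1 : ℂ) + Complex.I * (S.velDeriv c g J Complex.I : ℂ)) / 2

/-- `Π^c`, along a field. -/
def mom (φ : Field C M) (c : C) (g : M) (t : ℝ) : ℂ := S.momentumJet c g (jet φ g t)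

/-- `Π̄^c`, along a field. -/
def momBar (φ : Field C M) (c : C) (g : M) (t : ℝ) : ℂ := S.momentumBarJet c g (jet φ g t)

end Model

/-- A one-parameter group of Lie point transformations of the bundle `(M × ℝ) × ℂ^C`,
`(g, t, u) ↦ (base s g t u, clock s t, fiber s g t u)`, that respects the slicing by `t`. -/
structure PointFlow (C : Type w) [Fintype C] (M : HaarLieGroup.{u}) where
  base : ℝ → M → ℝ → Fib C → M
  clock : ℝ → ℝ → ℝ
  fiber : ℝ → M → ℝ → Fib C → Fib C
  base_smooth : ContMDiff (𝓘(ℝ, ℝ).prod (M.I.prod 𝓘(ℝ, ℝ × Fib C))) M.I ∞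
    (fun z : ℝ × (M × (ℝ × Fib C)) => base z.1 z.2.1 z.2.2.1 z.2.2.2)
  clock_smooth : ContDiff ℝ ∞ (fun z : ℝ × ℝ => clock z.1 z.2)
  fiber_smooth : ContMDiff (𝓘(ℝ, ℝ).prod (M.I.prod 𝓘(ℝ, ℝ × Fib C))) 𝓘(ℝ, Fib C) ∞
    (fun z : ℝ × (M × (ℝ × Fib C)) => fiber z.1 z.2.1 z.2.2.1 z.2.2.2)
  base_zero : ∀ g t u, base 0 g t u = g
  clock_zero : ∀ t, clock 0 t = t
  fiber_zero : ∀ g t u, fiber 0 g t u = u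
  base_add : ∀ r s g t u, base (r + s) g t u = base r (base s g t u) (clock s t) (fiber s g t u)
  clock_add : ∀ r s t, clock (r + s) t = clock r (clock s t)
  fiber_add : ∀ r s g t u, fiber (r + s) g t u = fiber r (base s g t u) (clock s t) (fiber s g t u)

namespace PointFlow

variable (Φ : PointFlow C M)

/-- `ψ` is the transform of `φ` by the transformation with parameter `s`, over the clock values in
`J`: the transformation maps the graph of `φ` over `M × J` into the graph of `ψ`. -/
def Transforms (s : ℝ) (J : Set ℝ) (φ ψ : Field C M) : Prop :=
  ∀ g, ∀ t ∈ J, ∀ c,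
    ψ c (Φ.base s g t (val φ g t)) (Φ.clock s t) = Φ.fiber s g t (val φ g t) c

/-- The transformation of the base manifold `M × ℝ` determined by a field `φ`. -/
def baseMap (s : ℝ) (φ : Field C M) (p : M × ℝ) : M × ℝ :=
  (Φ.base s p.1 p.2 (val φ p.1 p.2), Φ.clock s p.2)

/-- `K` is the base part of the one-parameter group of transformations that `Φ` induces on the bundle
of the interaction term `T`, the pullback of `arity` copies of the field bundle along `legs`. -/
structure IsLift (T : Interaction C M)
    (K : ℝ → T.Ω → ℝ → (Fin T.arity → Fib C) → T.Ω) : Prop where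
  smooth : ContMDiff (𝓘(ℝ, ℝ).prod (T.Ω.I.prod 𝓘(ℝ, ℝ × (Fin T.arity → Fib C)))) T.Ω.I ∞
    (fun z : ℝ × (T.Ω × (ℝ × (Fin T.arity → Fib C))) => K z.1 z.2.1 z.2.2.1 z.2.2.2)
  zero : ∀ x t w, K 0 x t w = x
  add : ∀ r s x t w, K (r + s) x t w =
    K r (K s x t w) (Φ.clock s t) (fun j => Φ.fiber s (T.legs j x) t (w j))
  legs : ∀ s x t w j, T.legs j (K s x t w) = Φ.base s (T.legs j x) t (w j)

/-- The component `X_ℝ` of the generator along the clock direction. -/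
def clockGen (t : ℝ) : ℝ := deriv (fun s => Φ.clock s t) 0

/-- The component `X_V` of the generator along the fibre, at the value of the field. -/
def fiberGen (φ : Field C M) (c : C) (g : M) (t : ℝ) : ℂ :=
  deriv (fun s => Φ.fiber s g t (val φ g t) c) 0

/-- The Lie derivative of a function `q` on `M × ℝ` along the base component `X_M + X_ℝ ∂_t` of the
generator, taken at the value of the field `φ`. -/
def lieDeriv (φ : Field C M) (q : M → ℝ → ℂ) (g : M) (t : ℝ) : ℂ :=
  deriv (fun s => q (Φ.base s g t (val φ g t)) (Φ.clock s t)) 0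

/-- The characteristic `X_Q^c = X_V^c - X(φ^c)`, with `X = X_M + X_ℝ ∂_t`. -/
def char (φ : Field C M) (c : C) (g : M) (t : ℝ) : ℂ :=
  Φ.fiberGen φ c g t - Φ.lieDeriv φ (φ c) g t

end PointFlow

namespace Model

variable (S : Model C M)

/-- Symmetries of the action: the transformations preserve the field space, and they are Lie point
symmetries of each functional in the action sum, that is, each functional over each subdomain is equal
to the same functional of the transformed field over the transformed subdomain. -/
structure IsSymmetry (Φ : PointFlow C M) : Prop where
  preserves : ∀ s, ∀ J : Set ℝ, IsOpen J → ∀ φ ψ, S.Admissible φ → Smooth ψ →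
    Φ.Transforms s J φ ψ →
    ∀ k ∈ S.constraints, ∀ c g, ∀ t ∈ J, ψ c (k g) (Φ.clock s t) = ψ c g (Φ.clock s t)
  loc : ∀ s, ∀ J : Set ℝ, IsOpen J → ∀ φ ψ, S.Admissible φ → S.Admissible ψ →
    Φ.Transforms s J φ ψ → ∀ A : Set (M × ℝ), IsCompact A → A ⊆ univ ×ˢ J →
    S.locAction ψ (Φ.baseMap s φ '' A) = S.locAction φ A
  inter : ∀ i, ∃ K, Φ.IsLift (S.inter i) K ∧
    ∀ s, ∀ J : Set ℝ, IsOpen J → ∀ φ ψ, S.Admissible φ → S.Admissible ψ →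
    Φ.Transforms s J φ ψ → ∀ A : Set ((S.inter i).Ω × ℝ), IsCompact A → A ⊆ univ ×ˢ J →
    (S.inter i).action ψ
      ((fun p => (K s p.1 p.2 ((S.inter i).legVals φ p.1 p.2), Φ.clock s p.2)) '' A) =
    (S.inter i).action φ A

/-- The charge
`Q(t) = S|_t X_ℝ(t) + ∫_M ∑_c (∂L/∂(∂_t φ^c) X_Q^c + ∂L/∂(∂_t φ̄^c) X̄_Q^c)`. -/
def charge (Φ : PointFlow C M) (φ : Field C M) (t : ℝ) : ℂ :=
  ((S.sliceAction φ t * Φ.clockGen t : ℝ) : ℂ) +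
    ∫ g, ∑ c, (S.mom φ c g t * Φ.char φ c g t +
      S.momBar φ c g t * (starRingEnd ℂ) (Φ.char φ c g t)) ∂M.haar

/-- The model does not depend explicitly on the clock variable. -/
def ClockIndependent : Prop :=
  (∀ g t t' u p v, S.locLagrangian g (t, u, p, v) = S.locLagrangian g (t', u, p, v)) ∧
  ∀ i x t t' w, (S.inter i).lagrangian x (t, w) = (S.inter i).lagrangian x (t', w)

end Model

lemma phase_contDiff (θ : ℝ) :
    ContDiff ℝ ∞ (fun z : ℝ × ℂ => Complex.exp (Complex.I * z.1 * θ) * z.2) := by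
  have h0 : ContDiff ℝ ∞ (fun x : ℝ => (x : ℂ)) := Complex.ofRealCLM.contDiff
  have h1 : ContDiff ℝ ∞ (fun z : ℝ × ℂ => (z.1 : ℂ)) := h0.comp contDiff_fst
  have h2 : ContDiff ℝ ∞ (fun z : ℝ × ℂ => Complex.I * (z.1 : ℂ) * θ) :=
    (contDiff_const.mul h1).mul contDiff_const
  exact h2.cexp.mul contDiff_snd

lemma phase_comp {X : Type*} [TopologicalSpace X] {H : Type*} [TopologicalSpace H] {E : Type*}
    [NormedAddCommGroup E] [NormedSpace ℝ E] {I : ModelWithCorners ℝ E H} [ChartedSpace H X]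
    {a : X → ℝ} {b : X → ℂ} (ha : ContMDiff I 𝓘(ℝ, ℝ) ∞ a) (hb : ContMDiff I 𝓘(ℝ, ℂ) ∞ b) (θ : ℝ) :
    ContMDiff I 𝓘(ℝ, ℂ) ∞ (fun x => Complex.exp (Complex.I * a x * θ) * b x) := by
  have h := (phase_contDiff θ).contMDiff.comp (ha.prodMk_space hb)
  exact h

lemma phase_smooth (M : HaarLieGroup.{u}) (θ : C → ℝ) :
    ContMDiff (𝓘(ℝ, ℝ).prod (M.I.prod 𝓘(ℝ, ℝ × Fib C))) 𝓘(ℝ, Fib C) ∞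
      (fun z : ℝ × (M × (ℝ × Fib C)) =>
        (fun c => Complex.exp (Complex.I * z.1 * θ c) * z.2.2.2 c : Fib C)) := by
  refine contMDiff_pi_space.2 fun c => ?_
  have h1 : ContMDiff (𝓘(ℝ, ℝ).prod (M.I.prod 𝓘(ℝ, ℝ × Fib C))) 𝓘(ℝ, ℝ) ∞
      (fun z : ℝ × (M × (ℝ × Fib C)) => z.1) := contMDiff_fst
  have h2 : ContMDiff (𝓘(ℝ, ℝ).prod (M.I.prod 𝓘(ℝ, ℝ × Fib C))) 𝓘(ℝ, ℂ) ∞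
      (fun z : ℝ × (M × (ℝ × Fib C)) => z.2.2.2 c) := by
    have h3 : ContDiff ℝ ∞ (fun y : ℝ × Fib C => y.2 c) := by fun_prop
    have h4 : ContMDiff (𝓘(ℝ, ℝ).prod (M.I.prod 𝓘(ℝ, ℝ × Fib C))) (M.I.prod 𝓘(ℝ, ℝ × Fib C)) ∞
        (fun z : ℝ × (M × (ℝ × Fib C)) => z.2) := contMDiff_snd
    exact h3.contMDiff.comp h4.snd
  exact phase_comp h1 h2 _

/-- The group of phase rotations `φ^c ↦ exp(i s θ_c) φ^c`. -/
def phaseFlow (M : HaarLieGroup.{u}) (θ : C → ℝ) : PointFlow C M where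
  base _ g _ _ := g
  clock _ t := t
  fiber s _ _ u := fun c => Complex.exp (Complex.I * s * θ c) * u c
  base_smooth := by
    have h : ContMDiff (𝓘(ℝ, ℝ).prod (M.I.prod 𝓘(ℝ, ℝ × Fib C))) (M.I.prod 𝓘(ℝ, ℝ × Fib C)) ∞
        (fun z : ℝ × (M × (ℝ × Fib C)) => z.2) := contMDiff_snd
    exact h.fst
  clock_smooth := contDiff_snd
  fiber_smooth := phase_smooth M θ
  base_zero _ _ _ := rfl
  clock_zero _ := rfl
  fiber_zero _ _ u := by funext c; simp
  base_add _ _ _ _ _ := rfl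
  clock_add _ _ _ := rfl
  fiber_add r s g t u := by
    funext c
    rw [← mul_assoc, ← Complex.exp_add]
    push_cast
    ring_nf

/-- The group of translations `t ↦ t + s` of the clock variable. -/
def translationFlow (C : Type w) [Fintype C] (M : HaarLieGroup.{u}) : PointFlow C M where
  base _ g _ _ := g
  clock s t := t + s
  fiber _ _ _ u := u
  base_smooth := by
    have h : ContMDiff (𝓘(ℝ, ℝ).prod (M.I.prod 𝓘(ℝ, ℝ × Fib C))) (M.I.prod 𝓘(ℝ, ℝ × Fib C)) ∞
        (fun z : ℝ × (M × (ℝ × Fib C)) => z.2) := contMDiff_snd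
    exact h.fst
  clock_smooth := contDiff_snd.add contDiff_fst
  fiber_smooth := by
    have h : ContMDiff (𝓘(ℝ, ℝ).prod (M.I.prod 𝓘(ℝ, ℝ × Fib C))) (M.I.prod 𝓘(ℝ, ℝ × Fib C)) ∞
        (fun z : ℝ × (M × (ℝ × Fib C)) => z.2) := contMDiff_snd
    have h1 : ContDiff ℝ ∞ (fun y : ℝ × Fib C => y.2) := contDiff_snd
    exact h1.contMDiff.comp h.snd
  base_zero _ _ _ := rfl
  clock_zero t := by simp
  fiber_zero _ _ _ := rfl
  base_add _ _ _ _ _ := rfl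
  clock_add r s t := by ring
  fiber_add _ _ _ _ _ := rfl

/-- The transformations act on `M` alone: the clock variable and the field values do not change. -/
def PointFlow.IsPureBase (Φ : PointFlow C M) : Prop :=
  (∀ s t, Φ.clock s t = t) ∧ ∀ s g t u, Φ.fiber s g t u = u

/-- `M` is identified with `SU(2)^n` by `e`, and the transformations of `M` are the multiplications
by one-parameter subgroups, `g_i ↦ exp(s A_i) g_i exp(s B_i)` with `A_i, B_i ∈ 𝔰𝔲(2)`. The case `B = 0` is
left multiplication, the case `A = 0` is the flow of left invariant vector fields. -/
def PointFlow.IsSU2Translation (Φ : PointFlow C M) {n : ℕ}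
    (e : M ≃* (Fin n → Matrix.specialUnitaryGroup (Fin 2) ℂ))
    (A B : Fin n → Matrix (Fin 2) (Fin 2) ℂ) : Prop :=
  Continuous e ∧ Φ.IsPureBase ∧
    (∀ i, (A i).conjTranspose = -A i ∧ (A i).trace = 0) ∧
    (∀ i, (B i).conjTranspose = -B i ∧ (B i).trace = 0) ∧
    ∀ s g t u i, (e (Φ.base s g t u) i : Matrix (Fin 2) (Fin 2) ℂ) =
      NormedSpace.exp (s • A i) * (e g i : Matrix (Fin 2) (Fin 2) ℂ) * NormedSpace.exp (s • B i)

end GFT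

end

/-!
A symmetry with small parameter `s` carries a field to one whose values solve a fixed-point equation
in the fibre, contracting near `s = 0` uniformly on compact sets. This yields a smooth family of
admissible transforms over any bounded range of the clock, and its derivative at `s = 0` is the
characteristic `δ` there. Differentiating the invariance of the action over the moving slab
`[ρ_s(a), ρ_s(b)]` gives `(S|_t X_ℝ)' = -E`, where `E t` is the first variation of `S|_t` along `δ`.

On the other hand, `δ` multiplied by a function `χ` of the clock alone changes `S|_t` to first order
by `χ E + χ' P`, with `P = ∫_M ∑_c (Π^c δ^c + Π̄^c δ̄^c)`: the interactions contain no derivatives,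
so `χ'` meets only the momenta. On shell these contributions integrate to zero for every compactly
supported `χ`, whence `P' = E` by the du Bois-Reymond lemma. The charge `S|_t X_ℝ + P` is therefore
constant. The remaining claims are computations with the Wirtinger derivatives.
-/

noncomputable section

section Calculus

open Topology Function

variable {G E F : Type*} [NormedAddCommGroup G] [NormedSpace ℝ G] [NormedAddCommGroup E]
  [NormedSpace ℝ E] [NormedAddCommGroup F] [NormedSpace ℝ F]

lemma fderiv_uncurry_right {f : G → E → F} {x : G} {y : E}
    (hf : DifferentiableAt ℝ (uncurry f) (x, y)) :
    fderiv ℝ (f x) y = fderiv ℝ (uncurry f) (x, y) ∘L .inr ℝ G E :=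
  (hf.hasFDerivAt.comp y (hasFDerivAt_prodMk_right x y)).fderiv

lemma fderiv_uncurry_left {f : G → E → F} {x : G} {y : E}
    (hf : DifferentiableAt ℝ (uncurry f) (x, y)) :
    fderiv ℝ (fun z => f z y) x = fderiv ℝ (uncurry f) (x, y) ∘L .inl ℝ G E :=
  (HasFDerivAt.comp (f := fun z => (z, y)) x hf.hasFDerivAt (hasFDerivAt_prodMk_left x y)).fderiv

lemma hasDerivAt_fderiv_comm {f : ℝ → E → F} {s : ℝ} {y : E}
    (hf : ContDiffAt ℝ 2 (uncurry f) (s, y)) :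
    HasDerivAt (fun r => fderiv ℝ (f r) y) (fderiv ℝ (fun z => deriv (fun r => f r z) s) y) s := by
  have hdiff : ∀ᶠ p in 𝓝 (s, y), DifferentiableAt ℝ (uncurry f) p :=
    (hf.eventually (by simp)).mono fun p hp => hp.differentiableAt two_ne_zero
  have hD : HasFDerivAt (fderiv ℝ (uncurry f)) (fderiv ℝ (fderiv ℝ (uncurry f)) (s, y)) (s, y) :=
    ((hf.fderiv_right (m := 1) (by norm_num)).differentiableAt one_ne_zero).hasFDerivAt
  have hleft : (fun r => fderiv ℝ (f r) y) =ᶠ[𝓝 s]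
      fun r => fderiv ℝ (uncurry f) (r, y) ∘L .inr ℝ ℝ E :=
    ((by fun_prop : Continuous fun r : ℝ => (r, y)).tendsto s |>.eventually hdiff).mono
      fun r hr => fderiv_uncurry_right hr
  have hright : (fun z => deriv (fun r => f r z) s) =ᶠ[𝓝 y]
      fun z => fderiv ℝ (uncurry f) (s, z) (1, 0) :=
    ((by fun_prop : Continuous fun z : E => (s, z)).tendsto y |>.eventually hdiff).mono
      fun z hz => by
        simp [← fderiv_apply_one_eq_deriv, fderiv_uncurry_left (f := f) (x := s) (y := z) hz]
  have hleft' := (HasFDerivAt.comp (f := fun r => (r, y)) s hD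
    (hasFDerivAt_prodMk_left s y)).hasDerivAt.clm_comp
    (hasDerivAt_const s (ContinuousLinearMap.inr ℝ ℝ E))
  have hright' := (HasFDerivAt.comp (f := fun z => (s, z)) y hD
    (hasFDerivAt_prodMk_right s y)).clm_apply (hasFDerivAt_const ((1 : ℝ), (0 : E)) y)
  refine (hleft'.congr_of_eventuallyEq hleft).congr_deriv ?_
  rw [hright.fderiv_eq]
  refine Eq.trans ?_ hright'.fderiv.symm
  have hsymm : IsSymmSndFDerivAt ℝ (uncurry f) (s, y) := hf.isSymmSndFDerivAt (by simp)
  ext v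
  simpa using hsymm.eq (1, 0) (0, v)

lemma deriv_diagonal {f : ℝ → ℝ → F} {t : ℝ} (hf : DifferentiableAt ℝ (uncurry f) (t, t)) :
    deriv (fun r => f r r) t = deriv (fun r => f r t) t + deriv (f t) t := by
  have hdiag : HasDerivAt (fun r => uncurry f (r, r)) _ t :=
    HasFDerivAt.comp_hasDerivAt (f := fun r => (r, r)) t hf.hasFDerivAt
      ((hasDerivAt_id t).prodMk (hasDerivAt_id t))
  rw [← fderiv_apply_one_eq_deriv (f := fun r => f r t), ← fderiv_apply_one_eq_deriv (f := f t),
    fderiv_uncurry_left hf, fderiv_uncurry_right hf]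
  refine hdiag.deriv.trans ?_
  simp [← map_add]

end Calculus

section ManifoldCalculus

open Topology Function

variable {E F E' H' P : Type*} [NormedAddCommGroup E] [NormedSpace ℝ E] [NormedAddCommGroup F]
  [NormedSpace ℝ F] [NormedAddCommGroup E'] [NormedSpace ℝ E'] [TopologicalSpace H']
  {J : ModelWithCorners ℝ E' H'} [TopologicalSpace P] [ChartedSpace H' P] {m n : ℕ∞ω}

lemma contMDiffAt_fderiv_param [IsManifold J 1 P] {f : P → E → F} {g : P → E} {p : P}
    (hf : ContMDiffAt (J.prod 𝓘(ℝ, E)) 𝓘(ℝ, F) n (uncurry f) (p, g p))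
    (hg : ContMDiffAt J 𝓘(ℝ, E) m g p) (hmn : m + 1 ≤ n) :
    ContMDiffAt J 𝓘(ℝ, E →L[ℝ] F) m (fun q => fderiv ℝ (f q) (g q)) p := by
  have hcoord := inTangentCoordinates_model_space (I := 𝓘(ℝ, E)) (I' := 𝓘(ℝ, F)) g
    (fun q => f q (g q)) (fun q => fderiv ℝ (f q) (g q)) p
  simpa only [mfderiv_eq_fderiv, hcoord] using ContMDiffAt.mfderiv f g hf hg hmn

lemma contMDiffAt_deriv_param [IsManifold J 1 P] {f : P → ℝ → F} {g : P → ℝ} {p : P}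
    (hf : ContMDiffAt (J.prod 𝓘(ℝ, ℝ)) 𝓘(ℝ, F) n (uncurry f) (p, g p))
    (hg : ContMDiffAt J 𝓘(ℝ, ℝ) m g p) (hmn : m + 1 ≤ n) :
    ContMDiffAt J 𝓘(ℝ, F) m (fun q => deriv (f q) (g q)) p := by
  simpa only [fderiv_apply_one_eq_deriv] using
    (contMDiffAt_fderiv_param hf hg hmn).clm_apply (contMDiffAt_const (c := (1 : ℝ)))

lemma contMDiff_smul_of_tsupport_subset {χ : P → ℝ} {v : P → F} {U : Set P} (hU : IsOpen U)
    (hχ : ContMDiff J 𝓘(ℝ, ℝ) n χ) (hv : ContMDiffOn J 𝓘(ℝ, F) n v U) (hsupp : tsupport χ ⊆ U) :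
    ContMDiff J 𝓘(ℝ, F) n fun p => χ p • v p :=
  contMDiff_of_tsupport fun p hp =>
    (hχ p).smul (hv.contMDiffAt (hU.mem_nhds (hsupp (tsupport_smul_subset_left χ v hp))))

end ManifoldCalculus

section FixedPoint

open Topology Metric Function
open scoped NNReal

lemma existsUnique_fixedPoint_of_nnnorm_fderiv_le {E : Type*} [NormedAddCommGroup E]
    [NormedSpace ℝ E] [CompleteSpace E] {N : E → E} {c : E} {r : ℝ} (hr : 0 ≤ r)
    {K : ℝ≥0} (hK : K < 1) (hN : ∀ u ∈ closedBall c r, DifferentiableAt ℝ N u)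
    (hN' : ∀ u ∈ closedBall c r, ‖fderiv ℝ N u‖₊ ≤ K)
    (hmaps : MapsTo N (closedBall c r) (closedBall c r)) :
    ∃! u, u ∈ closedBall c r ∧ N u = u := by
  have hlip := (convex_closedBall c r).lipschitzOnWith_of_nnnorm_fderiv_le hN hN'
  have hcontr : ContractingWith K (hmaps.restrict N _ _) := ⟨hK, hlip.mapsToRestrict hmaps⟩
  obtain ⟨u, hu, hfix, -⟩ := hcontr.exists_fixedPoint' isClosed_closedBall.isComplete hmaps
    (mem_closedBall_self hr) (edist_ne_top _ _)
  refine ⟨u, ⟨hu, hfix⟩, fun u' hu' => ?_⟩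
  have := hcontr.fixedPoint_unique' (x := ⟨u', hu'.1⟩) (y := ⟨u, hu⟩)
    (Subtype.ext hu'.2) (Subtype.ext hfix)
  exact congrArg Subtype.val this

variable {F E' H' P : Type*} [NormedAddCommGroup F] [NormedSpace ℝ F] [CompleteSpace F]
  [NormedAddCommGroup E'] [NormedSpace ℝ E'] [CompleteSpace E'] [TopologicalSpace H']
  {J : ModelWithCorners ℝ E' H'} [J.Boundaryless] [TopologicalSpace P] [ChartedSpace H' P]
  {n : ℕ∞ω}

lemma exists_contDiffAt_eventually_fixedPoint {N : E' → F → F} {x : E'} {u : F} (hn : n ≠ 0)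
    (hN : ContDiffAt ℝ n (uncurry N) (x, u)) (hfix : N x u = u) (hlt : ‖fderiv ℝ (N x) u‖ < 1) :
    ∃ v : E' → F, ContDiffAt ℝ n v x ∧ v x = u ∧ ∀ᶠ y in 𝓝 x, N y (v y) = v y := by
  let f : E' × F → F := fun q => q.2 - N q.1 q.2
  have hf : ContDiffAt ℝ n f (x, u) := contDiffAt_snd.sub hN
  have hpartial : fderiv ℝ f (x, u) ∘L .inr ℝ E' F = 1 - fderiv ℝ (N x) u := by
    have hNx : DifferentiableAt ℝ (N x) u :=
      (hN.differentiableAt hn).comp (f := fun w => (x, w)) u (by fun_prop)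
    refine (fderiv_uncurry_right (f := fun y w => w - N y w) (hf.differentiableAt hn)).symm.trans ?_
    exact (fderiv_fun_sub differentiableAt_fun_id hNx).trans (by simp [ContinuousLinearMap.one_def])
  have hinv : (fderiv ℝ f (x, u) ∘L .inr ℝ E' F).IsInvertible :=
    ⟨ContinuousLinearEquiv.ofUnit (Units.oneSub _ hlt), hpartial.symm⟩
  refine ⟨hf.implicitFunction hn hinv, hf.contDiffAt_implicitFunction hn hinv,
    hf.implicitFunction_apply_self hn hinv, ?_⟩
  filter_upwards [hf.eventually_apply_implicitFunction hn hinv] with y hy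
  exact (sub_eq_zero.1 (hy.trans (sub_eq_zero.2 hfix.symm))).symm

lemma exists_contMDiffAt_eventually_fixedPoint [IsManifold J n P] {N : P → F → F} {p : P} {u : F}
    (hn : n ≠ 0) (hN : ContMDiffAt (J.prod 𝓘(ℝ, F)) 𝓘(ℝ, F) n (uncurry N) (p, u))
    (hfix : N p u = u) (hlt : ‖fderiv ℝ (N p) u‖ < 1) :
    ∃ v : P → F, ContMDiffAt J 𝓘(ℝ, F) n v p ∧ v p = u ∧ ∀ᶠ q in 𝓝 p, N q (v q) = v q := by
  set e := extChartAt J p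
  have hep : e.symm (e p) = p := extChartAt_to_inv p
  have hsymm : ContMDiffAt 𝓘(ℝ, E') J n e.symm (e p) :=
    (contMDiffOn_extChartAt_symm p).contMDiffAt (extChartAt_target_mem_nhds p)
  have hN' : ContDiffAt ℝ n (uncurry fun x => N (e.symm x)) (e p, u) := by
    rw [← contMDiffAt_iff_contDiffAt]
    refine ContMDiffAt.comp (e p, u) (g := uncurry N) (f := fun q : E' × F => (e.symm q.1, q.2))
      (by rwa [hep]) (.prodMk ?_ contDiff_snd.contMDiff.contMDiffAt)
    exact ContMDiffAt.comp (e p, u) (f := Prod.fst) hsymm contDiff_fst.contMDiff.contMDiffAt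
  obtain ⟨v, hv, hv0, hfix'⟩ := exists_contDiffAt_eventually_fixedPoint hn hN'
    (by rwa [hep]) (by rwa [hep])
  refine ⟨v ∘ e, hv.contMDiffAt.comp p contMDiffAt_extChartAt, hv0, ?_⟩
  filter_upwards [(continuousAt_extChartAt (I := J) p).eventually hfix',
    extChartAt_source_mem_nhds (I := J) p] with q hq hqs
  rwa [(extChartAt J p).left_inv hqs] at hq

lemma exists_contMDiffOn_fixedPoint [IsManifold J n P] (hn : n ≠ 0) {N : P → F → F} {U : Set P}
    (hU : IsOpen U) {c : F} {r : ℝ} (hr : 0 ≤ r) {K : ℝ≥0} (hK : K < 1)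
    (hN : ContMDiffOn (J.prod 𝓘(ℝ, F)) 𝓘(ℝ, F) n (uncurry N) (U ×ˢ univ))
    (hN' : ∀ p ∈ U, ∀ u ∈ closedBall c r, ‖fderiv ℝ (N p) u‖₊ ≤ K)
    (hmaps : ∀ p ∈ U, MapsTo (N p) (closedBall c r) (ball c r)) :
    ∃ v : P → F, ContMDiffOn J 𝓘(ℝ, F) n v U ∧
      ∀ p ∈ U, v p ∈ ball c r ∧ ∀ u ∈ closedBall c r, N p u = u ↔ u = v p := by
  have hNat : ∀ p ∈ U, ∀ u, ContMDiffAt (J.prod 𝓘(ℝ, F)) 𝓘(ℝ, F) n (uncurry N) (p, u) :=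
    fun p hp u => hN.contMDiffAt ((hU.prod isOpen_univ).mem_nhds ⟨hp, mem_univ u⟩)
  have hdiff : ∀ p ∈ U, ∀ u, DifferentiableAt ℝ (N p) u := fun p hp u =>
    (contMDiffAt_iff_contDiffAt.1 ((hNat p hp u).comp u
      (contMDiffAt_const.prodMk contMDiffAt_id))).differentiableAt hn
  have hexists : ∀ p ∈ U, ∃! u, u ∈ closedBall c r ∧ N p u = u := fun p hp =>
    existsUnique_fixedPoint_of_nnnorm_fderiv_le hr hK (fun u _ => hdiff p hp u) (hN' p hp)
      ((hmaps p hp).mono_right ball_subset_closedBall)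
  choose! v hv hunique using hexists
  have hball : ∀ p ∈ U, v p ∈ ball c r := fun p hp => (hv p hp).2 ▸ hmaps p hp (hv p hp).1
  refine ⟨v, fun p hp => ContMDiffAt.contMDiffWithinAt ?_, fun p hp => ⟨hball p hp,
    fun u hu => ⟨fun h => hunique p hp u ⟨hu, h⟩, fun h => h ▸ (hv p hp).2⟩⟩⟩
  obtain ⟨w, hw, hwp, hfix⟩ := exists_contMDiffAt_eventually_fixedPoint hn (hNat p hp (v p))
    (hv p hp).2 ((hN' p hp _ (hv p hp).1).trans_lt hK)
  refine hw.congr_of_eventuallyEq ?_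
  filter_upwards [hU.mem_nhds hp, hfix, hw.continuousAt (isOpen_ball.mem_nhds (hwp ▸ hball p hp))]
    with q hq hfixq hqball
  exact (hunique q hq _ ⟨ball_subset_closedBall hqball, hfixq⟩).symm

end FixedPoint

section ParametricIntegral

open Topology Function

variable {E : Type*} [NormedAddCommGroup E] [NormedSpace ℝ E]

lemma hasDerivAt_setIntegral_of_isCompact {X : Type*} [TopologicalSpace X] [T2Space X]
    [MeasurableSpace X] [OpensMeasurableSpace X] {μ : Measure X} [IsFiniteMeasureOnCompacts μ]
    {K : Set X} (hK : IsCompact K) {f f' : ℝ → X → E} (hf : ∀ s, Continuous (f s))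
    (hf' : Continuous (uncurry f')) (hderiv : ∀ s x, HasDerivAt (fun r => f r x) (f' s x) s)
    (s : ℝ) : HasDerivAt (fun r => ∫ x in K, f r x ∂μ) (∫ x in K, f' s x ∂μ) s := by
  obtain ⟨B, hB⟩ := ((isCompact_Icc (a := s - 1) (b := s + 1)).prod hK).bddAbove_image
    hf'.norm.continuousOn
  have hint : ∀ {h : X → E}, Continuous h → IntegrableOn h K μ := fun hh =>
    hh.continuousOn.integrableOn_compact hK
  refine (hasDerivAt_integral_of_dominated_loc_of_deriv_le (bound := fun _ => B)
    (Icc_mem_nhds (a := s - 1) (b := s + 1) (by linarith) (by linarith))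
    (.of_forall fun r => (hint (hf r)).aestronglyMeasurable) (hint (hf s))
    (hint (by fun_prop)).aestronglyMeasurable
    (ae_restrict_of_forall_mem hK.measurableSet fun x hx r hr =>
      hB (mem_image_of_mem (fun p : ℝ × X => ‖uncurry f' p‖) (mk_mem_prod hr hx)))
    (integrableOn_const hK.measure_ne_top)
    (.of_forall fun x r _ => hderiv r x)).2

lemma hasDerivAt_intervalIntegral_of_continuous {f f' : ℝ → ℝ → E} (hf : ∀ s, Continuous (f s))
    (hf' : Continuous (uncurry f')) (hderiv : ∀ s t, HasDerivAt (fun r => f r t) (f' s t) s)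
    (a b s : ℝ) : HasDerivAt (fun r => ∫ t in a..b, f r t) (∫ t in a..b, f' s t) s := by
  simp only [intervalIntegral.intervalIntegral_eq_integral_uIoc, uIoc,
    ← integral_Icc_eq_integral_Ioc]
  exact (hasDerivAt_setIntegral_of_isCompact isCompact_Icc hf hf' hderiv s).const_smul _

lemma hasDerivAt_smul_of_eq_zero {k : ℝ → ℝ} {m : ℝ → E} {k' s : ℝ} (hk : HasDerivAt k k' s)
    (hks : k s = 0) (hm : ContinuousAt m s) :
    HasDerivAt (fun r => k r • m r) (k' • m s) s := by
  rw [hasDerivAt_iff_tendsto_slope] at hk ⊢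
  refine (hk.smul (hm.tendsto.mono_left (nhdsWithin_le_nhds (s := {s}ᶜ)))).congr fun r => ?_
  simp [slope, hks, smul_smul]

variable [CompleteSpace E]

lemma hasDerivAt_intervalIntegral_moving_endpoint {f : ℝ → ℝ → E} (hf : Continuous (uncurry f))
    {β : ℝ → ℝ} {β' s : ℝ} (hβ : HasDerivAt β β' s) :
    HasDerivAt (fun r => ∫ t in β s..β r, f r t) (β' • f s (β s)) s := by
  have hrescale : ∀ r, ∫ t in β s..β r, f r t =
      (β r - β s) • ∫ x in (0 : ℝ)..1, f r (β s + (β r - β s) * x) := fun r => by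
    rw [intervalIntegral.smul_integral_comp_add_mul]
    simp
  have hmean : ContinuousAt (fun r => ∫ x in (0 : ℝ)..1, f r (β s + (β r - β s) * x)) s := by
    have hjoint : Continuous fun q : ℝ × ℝ => ∫ x in (0 : ℝ)..1, f q.1 (β s + (q.2 - β s) * x) :=
      intervalIntegral.continuous_parametric_intervalIntegral_of_continuous'
        (f := fun (q : ℝ × ℝ) x => f q.1 (β s + (q.2 - β s) * x))
        (hf.comp (by fun_prop :
          Continuous fun z : (ℝ × ℝ) × ℝ => (z.1.1, β s + (z.1.2 - β s) * z.2))) 0 1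
    exact hjoint.continuousAt.comp (f := fun r => (r, β r)) (continuousAt_id.prodMk hβ.continuousAt)
  simp only [hrescale]
  simpa using hasDerivAt_smul_of_eq_zero (hβ.sub_const (β s)) (sub_self _) hmean

lemma hasDerivAt_intervalIntegral_leibniz {f f' : ℝ → ℝ → E} (hf : Continuous (uncurry f))
    (hf' : Continuous (uncurry f')) (hderiv : ∀ s t, HasDerivAt (fun r => f r t) (f' s t) s)
    {α β : ℝ → ℝ} {α' β' s : ℝ} (hα : HasDerivAt α α' s) (hβ : HasDerivAt β β' s) :
    HasDerivAt (fun r => ∫ t in α r..β r, f r t)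
      ((∫ t in α s..β s, f' s t) + β' • f s (β s) - α' • f s (α s)) s := by
  have hcont : ∀ r, Continuous (f r) := fun r => by fun_prop
  have hint : ∀ r a b, IntervalIntegrable (f r) volume a b := fun r => (hcont r).intervalIntegrable
  have hsplit : ∀ r, ∫ t in α r..β r, f r t =
      (∫ t in α s..β s, f r t) + (∫ t in β s..β r, f r t) - ∫ t in α s..α r, f r t := fun r => by
    rw [intervalIntegral.integral_add_adjacent_intervals (hint _ _ _) (hint _ _ _),
      intervalIntegral.integral_interval_sub_left (hint _ _ _) (hint _ _ _)]
  simp only [hsplit]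
  exact ((hasDerivAt_intervalIntegral_of_continuous hcont hf' hderiv _ _ s).add
    (hasDerivAt_intervalIntegral_moving_endpoint hf hβ)).sub
    (hasDerivAt_intervalIntegral_moving_endpoint hf hα)

end ParametricIntegral

section DuBoisReymond

open Function

variable {E : Type*} [NormedAddCommGroup E] [NormedSpace ℝ E]

lemma integrable_smul_of_hasCompactSupport {χ : ℝ → ℝ} {q : ℝ → E} (hχ : Continuous χ)
    (hχs : HasCompactSupport χ) (hq : Continuous q) : Integrable fun t => χ t • q t :=
  (hχ.smul hq).integrable_of_hasCompactSupport hχs.smul_right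

variable [CompleteSpace E]

lemma exists_hasCompactSupport_deriv_eq {θ : ℝ → E} (hθ : ContDiff ℝ ∞ θ)
    (hsupp : HasCompactSupport θ) (hzero : ∫ t, θ t = 0) :
    ∃ χ : ℝ → E, ContDiff ℝ ∞ χ ∧ HasCompactSupport χ ∧ deriv χ = θ := by
  obtain ⟨R, -, hR⟩ := hsupp.isCompact.isBounded.subset_ball_lt 0 0
  have hsub : support θ ⊆ Ioo (-R) R := by
    simpa [Real.ball_eq_Ioo] using (subset_tsupport θ).trans hR
  let χ : ℝ → E := fun t => ∫ x in (-R)..t, θ x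
  have hderiv : ∀ t, HasDerivAt χ (θ t) t := fun t =>
    (hθ.continuous.integral_hasStrictDerivAt _ t).hasDerivAt
  have hderiv' : deriv χ = θ := funext fun t => (hderiv t).deriv
  refine ⟨χ, contDiff_infty_iff_deriv.2 ⟨fun t => (hderiv t).differentiableAt, by rwa [hderiv']⟩,
    .intro (isCompact_Icc (a := -R) (b := R)) fun t ht => ?_, hderiv'⟩
  rcases lt_or_ge t (-R) with hlt | hge
  · refine intervalIntegral.integral_zero_ae (.of_forall fun x hx => notMem_support.1 fun hne => ?_)
    rw [uIoc_of_ge hlt.le] at hx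
    exact hx.2.not_gt (hsub hne).1
  · have hRt : R < t := lt_of_not_ge fun hle => ht ⟨hge, hle⟩
    rw [← hzero]
    exact intervalIntegral.integral_eq_integral_of_support_subset
      (hsub.trans (Ioo_subset_Ioc_self.trans (Ioc_subset_Ioc_right hRt.le)))

lemma eq_of_integral_deriv_smul_eq_zero {Q : ℝ → E} (hQ : Continuous Q)
    (h : ∀ χ : ℝ → ℝ, ContDiff ℝ ∞ χ → HasCompactSupport χ → ∫ t, deriv χ t • Q t = 0) (a b : ℝ) :
    Q a = Q b := by
  let f : ContDiffBump (0 : ℝ) := ⟨1, 2, one_pos, one_lt_two⟩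
  let ρ := f.normed volume
  have hρ : ContDiff ℝ ∞ ρ := f.contDiff_normed
  have hρs : HasCompactSupport ρ := f.hasCompactSupport_normed
  suffices Q = fun _ => ∫ t, ρ t • Q t by rw [this]
  refine (hQ.ae_eq_iff_eq volume continuous_const).1 ?_
  refine ae_eq_of_integral_contDiff_smul_eq hQ.locallyIntegrable
    continuous_const.locallyIntegrable fun ψ hψ hψs => ?_
  have hψi : Integrable ψ := hψ.continuous.integrable_of_hasCompactSupport hψs
  have hρi : Integrable fun t => (∫ x, ψ x) * ρ t :=
    (hρ.continuous.integrable_of_hasCompactSupport hρs).const_mul _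
  obtain ⟨χ, hχ, hχs, hχ'⟩ := exists_hasCompactSupport_deriv_eq
    (θ := fun t => ψ t - (∫ x, ψ x) * ρ t) (hψ.sub (contDiff_const.mul hρ))
    (hψs.sub hρs.mul_left) (by
      rw [integral_sub hψi hρi, integral_const_mul, f.integral_normed, mul_one, sub_self])
  have hχQ := h χ hχ hχs
  simp only [hχ', sub_smul, mul_smul] at hχQ
  have hρQ : Integrable fun t => (∫ x, ψ x) • ρ t • Q t :=
    (integrable_smul_of_hasCompactSupport hρ.continuous hρs hQ).smul (∫ x, ψ x)
  rw [integral_sub (integrable_smul_of_hasCompactSupport hψ.continuous hψs hQ) hρQ,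
    integral_smul, sub_eq_zero] at hχQ
  rw [hχQ, integral_smul_const]

lemma hasDerivAt_of_integral_smul_add_deriv_smul_eq_zero {P p : ℝ → E} (hP : Continuous P)
    (hp : Continuous p) (h : ∀ χ : ℝ → ℝ, ContDiff ℝ ∞ χ → HasCompactSupport χ →
      ∫ t, (χ t • p t + deriv χ t • P t) = 0) (t : ℝ) : HasDerivAt P (p t) t := by
  let W : ℝ → E := fun t => ∫ x in (0 : ℝ)..t, p x
  have hW : ∀ t, HasDerivAt W (p t) t := fun t =>
    (hp.integral_hasStrictDerivAt 0 t).hasDerivAt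
  have hWc : Continuous W := continuous_iff_continuousAt.2 fun t => (hW t).continuousAt
  have hconst : ∀ s, (P - W) s = (P - W) t := fun s => by
    refine eq_of_integral_deriv_smul_eq_zero (hP.sub hWc) (fun χ hχ hχs => ?_) s t
    have hint : ∀ {q : ℝ → E}, Continuous q → Integrable fun s => χ s • q s :=
      integrable_smul_of_hasCompactSupport hχ.continuous hχs
    have hint' : ∀ {q : ℝ → E}, Continuous q → Integrable fun s => deriv χ s • q s :=
      integrable_smul_of_hasCompactSupport (hχ.continuous_deriv (by simp)) hχs.deriv
    have hparts : ∫ s, (χ s • p s + deriv χ s • W s) = 0 :=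
      integral_eq_zero_of_hasDerivAt_of_integrable
        (fun s => ((hχ.differentiable (by simp) s).hasDerivAt.smul (hW s)))
        ((hint hp).add (hint' hWc)) (hint hWc)
    have hdiff := (h χ hχ hχs).trans hparts.symm
    rw [integral_add (hint hp) (hint' hP),
      integral_add (hint hp) (hint' hWc), add_right_inj] at hdiff
    simp only [Pi.sub_apply, smul_sub]
    rw [integral_sub (hint' hP) (hint' hWc), hdiff, sub_self]
  have hPW : P = fun s => (P - W) t + W s := funext fun s => by simp [← hconst s]
  rw [hPW]
  exact (hW t).const_add _

end DuBoisReymond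

section FibreIntegral

open Function

variable {X E F E' H' : Type*} [TopologicalSpace X] [NormedAddCommGroup E] [NormedSpace ℝ E]
  [NormedAddCommGroup F] [NormedSpace ℝ F]

lemma continuous_integral_of_compactSpace {P : Type*} [TopologicalSpace P]
    [FirstCountableTopology P] [LocallyCompactSpace P] [CompactSpace X]
    [SecondCountableTopologyEither X F] [MeasurableSpace X] [OpensMeasurableSpace X]
    {μ : Measure X} [IsLocallyFiniteMeasure μ] {f : P → X → F} (hf : Continuous (uncurry f)) :
    Continuous fun p => ∫ x, f p x ∂μ := by
  simpa only [Measure.restrict_univ] using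
    continuous_parametric_integral_of_continuous (μ := μ) hf isCompact_univ

variable [NormedAddCommGroup E'] [NormedSpace ℝ E'] [TopologicalSpace H']
  {J : ModelWithCorners ℝ E' H'} [ChartedSpace H' X] {L : X → E → F}

lemma differentiable_fibre (hL : ContMDiff (J.prod 𝓘(ℝ, E)) 𝓘(ℝ, F) 1 (uncurry L)) (x : X) :
    Differentiable ℝ (L x) :=
  (contMDiff_iff_contDiff.1 (hL.comp (contMDiff_const.prodMk contMDiff_id))).differentiable
    one_ne_zero

variable [IsManifold J 1 X]

lemma continuous_fderiv_fibre (hL : ContMDiff (J.prod 𝓘(ℝ, E)) 𝓘(ℝ, F) 1 (uncurry L)) :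
    Continuous fun z : X × E => fderiv ℝ (L z.1) z.2 := by
  have h : ContMDiff (J.prod 𝓘(ℝ, E)) 𝓘(ℝ, E →L[ℝ] F) 0 fun z : X × E => fderiv ℝ (L z.1) z.2 :=
    fun z => contMDiffAt_fderiv_param (f := fun (z : X × E) e => L z.1 e) (g := Prod.snd)
      (ContMDiffAt.comp (z, z.2) (g := uncurry L) (f := fun q : (X × E) × E => (q.1.1, q.2)) (hL _)
        (contMDiffAt_fst.fst.prodMk contMDiffAt_snd)) contMDiffAt_snd (zero_add 1).le
  exact h.continuous

lemma hasDerivAt_integral_fibre [CompactSpace X] [T2Space X] [MeasurableSpace X]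
    [OpensMeasurableSpace X] {μ : Measure X} [IsFiniteMeasureOnCompacts μ]
    (hL : ContMDiff (J.prod 𝓘(ℝ, E)) 𝓘(ℝ, F) 1 (uncurry L)) {σ σ' : ℝ → X → E}
    (hσ : Continuous (uncurry σ)) (hσ' : Continuous (uncurry σ'))
    (hderiv : ∀ s x, HasDerivAt (fun r => σ r x) (σ' s x) s) (s : ℝ) :
    HasDerivAt (fun r => ∫ x, L x (σ r x) ∂μ) (∫ x, fderiv ℝ (L x) (σ s x) (σ' s x) ∂μ) s := by
  have hfderiv : Continuous fun z : ℝ × X => fderiv ℝ (L z.2) (σ z.1 z.2) :=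
    (continuous_fderiv_fibre hL).comp (continuous_snd.prodMk hσ)
  simpa only [Measure.restrict_univ] using hasDerivAt_setIntegral_of_isCompact (μ := μ)
    isCompact_univ (f := fun r x => L x (σ r x))
    (f' := fun r x => fderiv ℝ (L x) (σ r x) (σ' r x))
    (fun r => hL.continuous.comp (by fun_prop : Continuous fun x => (x, σ r x)))
    (hfderiv.clm_apply hσ')
    (fun r x => (differentiable_fibre hL x _).hasFDerivAt.comp_hasDerivAt r (hderiv r x)) s

end FibreIntegral

lemma setIntegral_univ_prod_Icc {X : Type*} [TopologicalSpace X] [CompactSpace X] [T2Space X]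
    [SecondCountableTopology X] [MeasurableSpace X] [OpensMeasurableSpace X] {μ : Measure X}
    [IsFiniteMeasure μ] {f : X × ℝ → ℝ} (hf : Continuous f) {a b : ℝ} (hab : a ≤ b) :
    ∫ p in univ ×ˢ Icc a b, f p ∂(μ.prod volume) = ∫ t in a..b, ∫ x, f (x, t) ∂μ := by
  have hint : IntegrableOn f (univ ×ˢ Icc a b) (μ.prod volume) :=
    hf.continuousOn.integrableOn_compact (isCompact_univ.prod isCompact_Icc)
  rw [IntegrableOn, ← Measure.prod_restrict, Measure.restrict_univ] at hint
  rw [← Measure.prod_restrict, Measure.restrict_univ, integral_prod_symm _ hint,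
    integral_Icc_eq_integral_Ioc, intervalIntegral.integral_of_le hab]

lemma sum_wirtinger_eq {C : Type*} [Fintype C] [DecidableEq C] (D : (C → ℂ) →ₗ[ℝ] ℝ)
    (v : C → ℂ) :
    ∑ c, ((D (Pi.single c 1) - Complex.I * D (Pi.single c Complex.I)) / 2 * v c +
      (D (Pi.single c 1) + Complex.I * D (Pi.single c Complex.I)) / 2 * starRingEnd ℂ (v c)) =
        (D v : ℂ) := by
  have hsingle : ∀ c, D (Pi.single c (v c)) =
      (v c).re * D (Pi.single c 1) + (v c).im * D (Pi.single c Complex.I) := fun c => by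
    rw [← smul_eq_mul, ← smul_eq_mul, ← map_smul, ← map_smul, ← map_add, ← Pi.single_smul,
      ← Pi.single_smul, ← Pi.single_add]
    simp [Complex.re_add_im]
  conv_rhs => rw [← Finset.univ_sum_single v, map_sum, Complex.ofReal_sum]
  refine Finset.sum_congr rfl fun c _ => ?_
  rw [hsingle]
  apply Complex.ext <;> simp <;> ring

lemma setIntegral_image_add_right_snd {X E : Type*} [MeasurableSpace X] [TopologicalSpace X]
    [SecondCountableTopology X] [BorelSpace X] [NormedAddCommGroup E] [NormedSpace ℝ E]
    {μ : Measure X} [SFinite μ] (f : X × ℝ → E) (s : ℝ) (A : Set (X × ℝ)) :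
    ∫ p in (fun p : X × ℝ => (p.1, p.2 + s)) '' A, f p ∂(μ.prod volume) =
      ∫ p in A, f (p.1, p.2 + s) ∂(μ.prod volume) :=
  MeasurePreserving.setIntegral_image_emb (f := fun p : X × ℝ => (p.1, p.2 + s))
    ((MeasurePreserving.id μ).prod (measurePreserving_add_right volume s))
    ((Homeomorph.refl X).prodCongr (Homeomorph.addRight s)).measurableEmbedding f A

lemma exists_contDiff_eqOn_one_tsupport_subset {E : Type*} [NormedAddCommGroup E]
    [NormedSpace ℝ E] [FiniteDimensional ℝ E] {K V : Set E} (hK : IsClosed K) (hV : IsOpen V)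
    (hKV : K ⊆ V) : ∃ χ : E → ℝ, ContDiff ℝ ∞ χ ∧ EqOn χ 1 K ∧ tsupport χ ⊆ V := by
  obtain ⟨χ, h0, h1, -⟩ := exists_contMDiffMap_zero_one_nhds_of_isClosed 𝓘(ℝ, E) (n := (⊤ : ℕ∞))
    hV.isClosed_compl hK (disjoint_compl_left_iff_subset.2 hKV)
  refine ⟨χ, χ.contMDiff.contDiff, fun x hx => h1.self_of_nhdsSet x hx, fun x hx => ?_⟩
  by_contra hxV
  have hzero : χ =ᶠ[nhds x] 0 := Filter.Eventually.filter_mono (nhds_le_nhdsSet hxV) h0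
  exact notMem_tsupport_iff_eventuallyEq.2 hzero hx

lemma image_univ_prod_of_surjective {X T X' T' : Type*} {k : X → T → X'} {c : T → T'} {A : Set T}
    (hk : ∀ t ∈ A, Function.Surjective fun x => k x t) :
    (fun p : X × T => (k p.1 p.2, c p.2)) '' (univ ×ˢ A) = univ ×ˢ (c '' A) := by
  ext ⟨y, r⟩
  constructor
  · rintro ⟨p, hp, h⟩
    exact ⟨mem_univ _, p.2, hp.2, congrArg Prod.snd h⟩
  · rintro ⟨-, t, ht, rfl⟩
    obtain ⟨x, rfl⟩ := hk t ht y
    exact ⟨(x, t), ⟨mem_univ x, ht⟩, rfl⟩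

namespace GFT

open Topology

section Families

variable {C : Type w} {M : HaarLieGroup.{u}}

/-- A smooth one-parameter family of field multiplets. -/
def SmoothFamily (Ψ : ℝ → Field C M) : Prop :=
  ∀ c, ContMDiff (𝓘(ℝ, ℝ).prod (M.I.prod 𝓘(ℝ, ℝ))) 𝓘(ℝ, ℂ) ∞
    (fun z : ℝ × (M × ℝ) => Ψ z.1 c z.2.1 z.2.2)

/-- The derivative of a family of fields with respect to the parameter. -/
def variation (Ψ : ℝ → Field C M) (s : ℝ) : Field C M :=
  fun c g t => deriv (fun r => Ψ r c g t) s

lemma Smooth.const_family {φ : Field C M} (hφ : Smooth φ) : SmoothFamily fun _ => φ :=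
  fun c => (hφ c).comp contMDiff_snd

lemma Smooth.contMDiff_slice {φ : Field C M} (hφ : Smooth φ) (c : C) (t : ℝ) :
    ContMDiff M.I 𝓘(ℝ, ℂ) ∞ fun g => φ c g t :=
  (hφ c).comp (contMDiff_id.prodMk contMDiff_const)

lemma Smooth.hasDerivAt {φ : Field C M} (hφ : Smooth φ) (c : C) (g : M) (t : ℝ) :
    HasDerivAt (fun r => φ c g r) (clockDeriv φ g t c) t := by
  have h : ContMDiff 𝓘(ℝ, ℝ) 𝓘(ℝ, ℂ) ∞ fun r : ℝ => φ c g r :=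
    (hφ c).comp (contMDiff_const.prodMk contMDiff_id)
  exact (h.contDiff.differentiable (by simp) t).hasDerivAt

lemma leftGrad_eq_fderiv {q : M → ℂ} (hq : ContMDiff M.I 𝓘(ℝ, ℂ) ∞ q) (g : M) :
    leftGrad q g = fderiv ℝ (fun y => q (g * (extChartAt M.I (1 : M)).symm y))
      (extChartAt M.I (1 : M) 1) := by
  have h : ContMDiff M.I 𝓘(ℝ, ℂ) ∞ fun h : M => q (g * h) :=
    hq.comp (contMDiff_const.mul contMDiff_id)
  refine (h.mdifferentiable (by simp) 1).mfderiv.trans ?_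
  rw [M.boundaryless.range_eq_univ, fderivWithin_univ]
  rfl

lemma contMDiffAt_mul_extChartAt_symm (g : M) :
    ContMDiffAt (M.I.prod 𝓘(ℝ, M.vec)) M.I ∞
      (fun p : M × M.vec => p.1 * (extChartAt M.I (1 : M)).symm p.2)
      (g, extChartAt M.I (1 : M) 1) := by
  have h : ContMDiffAt 𝓘(ℝ, M.vec) M.I ∞ (extChartAt M.I (1 : M)).symm (extChartAt M.I (1 : M) 1) :=
    (contMDiffOn_extChartAt_symm (1 : M)).contMDiffAt (extChartAt_target_mem_nhds (1 : M))
  exact contMDiffAt_fst.mul (ContMDiffAt.comp (g, extChartAt M.I (1 : M) 1) (f := Prod.snd) h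
    contMDiffAt_snd)

namespace SmoothFamily

variable {Ψ : ℝ → Field C M}

lemma smooth (hΨ : SmoothFamily Ψ) (s : ℝ) : Smooth (Ψ s) :=
  fun c => (hΨ c).comp (contMDiff_const.prodMk contMDiff_id)

lemma variation (hΨ : SmoothFamily Ψ) : SmoothFamily (variation Ψ) := fun c z => by
  have h : ContMDiff ((𝓘(ℝ, ℝ).prod (M.I.prod 𝓘(ℝ, ℝ))).prod 𝓘(ℝ, ℝ)) 𝓘(ℝ, ℂ) ∞
      (fun z : (ℝ × (M × ℝ)) × ℝ => Ψ z.2 c z.1.2.1 z.1.2.2) :=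
    (hΨ c).comp (contMDiff_snd.prodMk (contMDiff_fst.snd))
  exact contMDiffAt_deriv_param (f := fun (z : ℝ × (M × ℝ)) r => Ψ r c z.2.1 z.2.2) (g := Prod.fst)
    (h (z, z.1)) contMDiff_fst.contMDiffAt (by simp)

lemma hasDerivAt (hΨ : SmoothFamily Ψ) (s : ℝ) (c : C) (g : M) (t : ℝ) :
    HasDerivAt (fun r => Ψ r c g t) (GFT.variation Ψ s c g t) s := by
  have h : ContMDiff 𝓘(ℝ, ℝ) 𝓘(ℝ, ℂ) ∞ fun r : ℝ => Ψ r c g t :=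
    (hΨ c).comp (contMDiff_id.prodMk (contMDiff_const (c := (g, t))))
  exact (h.contDiff.differentiable (by simp) s).hasDerivAt

lemma contMDiff_leftGrad (hΨ : SmoothFamily Ψ) (c : C) :
    ContMDiff (𝓘(ℝ, ℝ).prod (M.I.prod 𝓘(ℝ, ℝ))) 𝓘(ℝ, M.vec →L[ℝ] ℂ) ∞
      (fun z : ℝ × (M × ℝ) => leftGrad (fun g => Ψ z.1 c g z.2.2) z.2.1) := fun z => by
  simp only [fun z : ℝ × (M × ℝ) =>
    leftGrad_eq_fderiv ((hΨ.smooth z.1).contMDiff_slice c z.2.2) z.2.1]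
  have hmul := ContMDiffAt.comp (z, extChartAt M.I (1 : M) 1)
    (f := fun p : (ℝ × (M × ℝ)) × M.vec => (p.1.2.1, p.2))
    (I := (𝓘(ℝ, ℝ).prod (M.I.prod 𝓘(ℝ, ℝ))).prod 𝓘(ℝ, M.vec))
    (contMDiffAt_mul_extChartAt_symm z.2.1) (contMDiffAt_fst.snd.fst.prodMk contMDiffAt_snd)
  exact contMDiffAt_fderiv_param
    (f := fun (z : ℝ × (M × ℝ)) y => Ψ z.1 c (z.2.1 * (extChartAt M.I (1 : M)).symm y) z.2.2)
    (g := fun _ => extChartAt M.I (1 : M) 1)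
    (ContMDiffAt.comp (z, extChartAt M.I (1 : M) 1) (hΨ c _)
      (contMDiffAt_fst.fst.prodMk (hmul.prodMk contMDiffAt_fst.snd.snd)))
    contMDiffAt_const (by simp)

lemma hasDerivAt_leftGrad (hΨ : SmoothFamily Ψ) (c : C) (s : ℝ) (g : M) (t : ℝ) :
    HasDerivAt (fun r => leftGrad (fun g => Ψ r c g t) g)
      (leftGrad (fun g => GFT.variation Ψ s c g t) g) s := by
  rw [leftGrad_eq_fderiv ((hΨ.variation.smooth s).contMDiff_slice c t) g]
  simp only [fun r => leftGrad_eq_fderiv ((hΨ.smooth r).contMDiff_slice c t) g]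
  have hmul := ContMDiffAt.comp (s, extChartAt M.I (1 : M) 1) (I := 𝓘(ℝ, ℝ × M.vec))
    (f := fun p : ℝ × M.vec => (g, p.2)) (contMDiffAt_mul_extChartAt_symm g)
    (contMDiffAt_const.prodMk contDiff_snd.contMDiff.contMDiffAt)
  have hΨs := ContMDiffAt.comp (s, extChartAt M.I (1 : M) 1) (hΨ c _)
    (contDiff_fst.contMDiff.contMDiffAt.prodMk (hmul.prodMk (contMDiffAt_const (c := t))))
  exact hasDerivAt_fderiv_comm
    (f := fun r y => Ψ r c (g * (extChartAt M.I (1 : M)).symm y) t)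
    (hΨs.contDiffAt.of_le (by norm_cast))

lemma clockDeriv (hΨ : SmoothFamily Ψ) :
    SmoothFamily fun s c g t => clockDeriv (Ψ s) g t c := fun c z => by
  have h : ContMDiff ((𝓘(ℝ, ℝ).prod (M.I.prod 𝓘(ℝ, ℝ))).prod 𝓘(ℝ, ℝ)) 𝓘(ℝ, ℂ) ∞
      (fun z : (ℝ × (M × ℝ)) × ℝ => Ψ z.1.1 c z.1.2.1 z.2) :=
    (hΨ c).comp (contMDiff_fst.fst.prodMk (contMDiff_fst.snd.fst.prodMk contMDiff_snd))
  exact contMDiffAt_deriv_param (f := fun (z : ℝ × (M × ℝ)) r => Ψ z.1 c z.2.1 r)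
    (g := fun z => z.2.2) (h (z, z.2.2)) contMDiff_snd.snd.contMDiffAt (by simp)

lemma hasDerivAt_clockDeriv (hΨ : SmoothFamily Ψ) (c : C) (s : ℝ) (g : M) (t : ℝ) :
    HasDerivAt (fun r => GFT.clockDeriv (Ψ r) g t c)
      (GFT.clockDeriv (GFT.variation Ψ s) g t c) s := by
  have hΨc : ContDiff ℝ ∞ fun p : ℝ × ℝ => Ψ p.1 c g p.2 :=
    contMDiff_iff_contDiff.1 ((hΨ c).comp (contDiff_fst.contMDiff.prodMk
      (contMDiff_const.prodMk contDiff_snd.contMDiff)))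
  have h := (hasDerivAt_fderiv_comm (f := fun r y => Ψ r c g y) (s := s) (y := t)
    (hΨc.contDiffAt.of_le (by norm_cast))).clm_apply (hasDerivAt_const s (1 : ℝ))
  simp only [fderiv_apply_one_eq_deriv, map_zero, add_zero] at h
  exact h

end SmoothFamily

/-- The tangent vector to the jet space along which the jet of a field multiplet moves when the
field is varied in the direction `δ`. -/
def jetVariation (δ : Field C M) (g : M) (t : ℝ) : Jet C M := (0, (jet δ g t).2)

variable {Ψ : ℝ → Field C M} {φ : Field C M}

lemma SmoothFamily.contMDiff_jet [Fintype C] (hΨ : SmoothFamily Ψ) :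
    ContMDiff (𝓘(ℝ, ℝ).prod (M.I.prod 𝓘(ℝ, ℝ))) 𝓘(ℝ, Jet C M) ∞
      (fun z : ℝ × (M × ℝ) => jet (Ψ z.1) z.2.1 z.2.2) :=
  contMDiff_snd.snd.prodMk_space ((contMDiff_pi_space.2 hΨ).prodMk_space
    ((contMDiff_pi_space.2 hΨ.contMDiff_leftGrad).prodMk_space
      (contMDiff_pi_space.2 hΨ.clockDeriv)))

lemma SmoothFamily.continuous_jetVariation [Finite C] (hΨ : SmoothFamily Ψ) :
    Continuous fun z : ℝ × (M × ℝ) => jetVariation (Ψ z.1) z.2.1 z.2.2 := by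
  cases nonempty_fintype C
  exact continuous_const.prodMk hΨ.contMDiff_jet.continuous.snd

lemma SmoothFamily.hasDerivAt_jet [Finite C] (hΨ : SmoothFamily Ψ) (s : ℝ) (g : M) (t : ℝ) :
    HasDerivAt (fun r => jet (Ψ r) g t) (jetVariation (GFT.variation Ψ s) g t) s := by
  cases nonempty_fintype C
  exact (hasDerivAt_const s t).prodMk ((hasDerivAt_pi.2 fun c => hΨ.hasDerivAt s c g t).prodMk
    ((hasDerivAt_pi.2 fun c => hΨ.hasDerivAt_leftGrad c s g t).prodMk
      (hasDerivAt_pi.2 fun c => hΨ.hasDerivAt_clockDeriv c s g t)))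

lemma SmoothFamily.contMDiff_val [Fintype C] (hΨ : SmoothFamily Ψ) :
    ContMDiff (𝓘(ℝ, ℝ).prod (M.I.prod 𝓘(ℝ, ℝ))) 𝓘(ℝ, Fib C) ∞
      (fun z : ℝ × (M × ℝ) => val (Ψ z.1) z.2.1 z.2.2) :=
  contMDiff_pi_space.2 hΨ

lemma Smooth.contMDiff_val [Fintype C] (hφ : Smooth φ) :
    ContMDiff (M.I.prod 𝓘(ℝ, ℝ)) 𝓘(ℝ, Fib C) ∞ (fun p : M × ℝ => val φ p.1 p.2) :=
  contMDiff_pi_space.2 hφ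

lemma Smooth.continuous_jet [Finite C] (hφ : Smooth φ) :
    Continuous fun p : M × ℝ => jet φ p.1 p.2 := by
  cases nonempty_fintype C
  exact hφ.const_family.contMDiff_jet.continuous.comp
    (by fun_prop : Continuous fun p => ((0 : ℝ), p))

end Families

section FirstVariation

variable {C : Type w} [Fintype C] {M : HaarLieGroup.{u}} {Ψ Δ : ℝ → Field C M} {φ δ : Field C M}

lemma Interaction.continuous_legVals (T : Interaction C M) (hΨ : SmoothFamily Ψ) :
    Continuous fun z : ℝ × (T.Ω × ℝ) => T.legVals (Ψ z.1) z.2.1 z.2.2 :=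
  continuous_pi fun j => hΨ.contMDiff_val.continuous.comp (continuous_fst.prodMk
    (((T.legs_smooth j).continuous.comp continuous_snd.fst).prodMk continuous_snd.snd))

lemma Interaction.hasDerivAt_legVals (T : Interaction C M) (hΨ : SmoothFamily Ψ) (s : ℝ) (x : T.Ω)
    (t : ℝ) : HasDerivAt (fun r => T.legVals (Ψ r) x t) (T.legVals (variation Ψ s) x t) s :=
  hasDerivAt_pi.2 fun j => hasDerivAt_pi.2 fun c => hΨ.hasDerivAt s c (T.legs j x) t

lemma Interaction.lagrangian_contMDiff_one (T : Interaction C M) :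
    ContMDiff (T.Ω.I.prod 𝓘(ℝ, ℝ × (Fin T.arity → Fib C))) 𝓘(ℝ, ℝ) 1
      (Function.uncurry T.lagrangian) :=
  T.lagrangian_smooth.of_le (by norm_cast)

namespace Model

variable (S : Model C M)

/-- The first variation of the action on the slice at `t`, at the field `φ` and in the direction
`δ`. -/
def sliceVar (φ δ : Field C M) (t : ℝ) : ℝ :=
  (∫ g, fderiv ℝ (S.locLagrangian g) (jet φ g t) (jetVariation δ g t) ∂M.haar) +
    ∑ i, ∫ x, fderiv ℝ ((S.inter i).lagrangian x) (t, (S.inter i).legVals φ x t)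
      (0, (S.inter i).legVals δ x t) ∂(S.inter i).Ω.haar

lemma locLagrangian_contMDiff_one :
    ContMDiff (M.I.prod 𝓘(ℝ, Jet C M)) 𝓘(ℝ, ℝ) 1 (Function.uncurry S.locLagrangian) :=
  S.locLagrangian_smooth.of_le (by norm_cast)

lemma continuous_sliceAction (hΨ : SmoothFamily Ψ) :
    Continuous fun p : ℝ × ℝ => S.sliceAction (Ψ p.1) p.2 := by
  refine .add ?_ (continuous_finsetSum _ fun i _ => ?_)
  · exact continuous_integral_of_compactSpace (f := fun (p : ℝ × ℝ) g =>
      S.locLagrangian g (jet (Ψ p.1) g p.2)) (S.locLagrangian_smooth.continuous.comp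
        (continuous_snd.prodMk (hΨ.contMDiff_jet.continuous.comp (by fun_prop :
          Continuous fun z : (ℝ × ℝ) × M => (z.1.1, z.2, z.1.2)))))
  · exact continuous_integral_of_compactSpace (f := fun (p : ℝ × ℝ) x =>
      (S.inter i).lagrangian x (p.2, (S.inter i).legVals (Ψ p.1) x p.2))
      ((S.inter i).lagrangian_smooth.continuous.comp (continuous_snd.prodMk
        (continuous_fst.snd.prodMk (((S.inter i).continuous_legVals hΨ).comp (by fun_prop :
          Continuous fun z : (ℝ × ℝ) × (S.inter i).Ω => (z.1.1, z.2, z.1.2))))))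

lemma continuous_sliceVar (hΨ : SmoothFamily Ψ) (hΔ : SmoothFamily Δ) :
    Continuous fun p : ℝ × ℝ => S.sliceVar (Ψ p.1) (Δ p.1) p.2 := by
  refine .add ?_ (continuous_finsetSum _ fun i _ => ?_)
  · have hperm : Continuous fun z : (ℝ × ℝ) × M => (z.1.1, z.2, z.1.2) := by fun_prop
    exact continuous_integral_of_compactSpace (f := fun (p : ℝ × ℝ) g =>
      fderiv ℝ (S.locLagrangian g) (jet (Ψ p.1) g p.2) (jetVariation (Δ p.1) g p.2))
      (((continuous_fderiv_fibre S.locLagrangian_contMDiff_one).comp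
        (continuous_snd.prodMk (hΨ.contMDiff_jet.continuous.comp hperm))).clm_apply
          (hΔ.continuous_jetVariation.comp hperm))
  · have hperm : Continuous fun z : (ℝ × ℝ) × (S.inter i).Ω => (z.1.1, z.2, z.1.2) := by fun_prop
    exact continuous_integral_of_compactSpace (f := fun (p : ℝ × ℝ) x =>
      fderiv ℝ ((S.inter i).lagrangian x) (p.2, (S.inter i).legVals (Ψ p.1) x p.2)
        (0, (S.inter i).legVals (Δ p.1) x p.2))
      (((continuous_fderiv_fibre (S.inter i).lagrangian_contMDiff_one).comp
        (continuous_snd.prodMk (continuous_fst.snd.prodMk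
          (((S.inter i).continuous_legVals hΨ).comp hperm)))).clm_apply
        (continuous_const.prodMk (((S.inter i).continuous_legVals hΔ).comp hperm)))

lemma hasDerivAt_sliceAction (hΨ : SmoothFamily Ψ) (s t : ℝ) :
    HasDerivAt (fun r => S.sliceAction (Ψ r) t) (S.sliceVar (Ψ s) (variation Ψ s) t) s := by
  refine .add ?_ (.fun_sum fun i _ => ?_)
  · have hperm : Continuous fun z : ℝ × M => (z.1, z.2, t) := by fun_prop
    exact hasDerivAt_integral_fibre S.locLagrangian_contMDiff_one (σ := fun r g => jet (Ψ r) g t)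
      (σ' := fun r g => jetVariation (variation Ψ r) g t)
      (hΨ.contMDiff_jet.continuous.comp hperm)
      (hΨ.variation.continuous_jetVariation.comp hperm) (fun r g => hΨ.hasDerivAt_jet r g t) s
  · have hperm : Continuous fun z : ℝ × (S.inter i).Ω => (z.1, z.2, t) := by fun_prop
    exact hasDerivAt_integral_fibre (S.inter i).lagrangian_contMDiff_one
      (σ := fun r x => (t, (S.inter i).legVals (Ψ r) x t))
      (σ' := fun r x => (0, (S.inter i).legVals (variation Ψ r) x t))
      (continuous_const.prodMk (((S.inter i).continuous_legVals hΨ).comp hperm))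
      (continuous_const.prodMk (((S.inter i).continuous_legVals hΨ.variation).comp hperm))
      (fun r x => (hasDerivAt_const r t).prodMk ((S.inter i).hasDerivAt_legVals hΨ r x t)) s

lemma action_eq_intervalIntegral_sliceAction (hφ : Smooth φ) {a b : ℝ} (hab : a ≤ b) :
    S.action φ a b = ∫ t in a..b, S.sliceAction φ t := by
  have hloc : Continuous fun p : M × ℝ => S.locLagrangian p.1 (jet φ p.1 p.2) :=
    S.locLagrangian_smooth.continuous.comp (continuous_fst.prodMk hφ.continuous_jet)
  have hinter : ∀ i, Continuous fun p : (S.inter i).Ω × ℝ =>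
      (S.inter i).lagrangian p.1 (p.2, (S.inter i).legVals φ p.1 p.2) := fun i =>
    (S.inter i).lagrangian_smooth.continuous.comp (continuous_fst.prodMk (continuous_snd.prodMk
      (((S.inter i).continuous_legVals hφ.const_family).comp
        (by fun_prop : Continuous fun p => ((0 : ℝ), p)))))
  have hint : ∀ {X : HaarLieGroup.{u}} {f : X × ℝ → ℝ}, Continuous f →
      Continuous fun t => ∫ x, f (x, t) ∂X.haar := fun {X f} hf =>
    continuous_integral_of_compactSpace (f := fun t x => f (x, t)) (hf.comp continuous_swap)
  have hslice : ∀ t, S.sliceAction φ t = (∫ g, S.locLagrangian g (jet φ g t) ∂M.haar) +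
      ∑ i, ∫ x, (S.inter i).lagrangian x (t, (S.inter i).legVals φ x t) ∂(S.inter i).Ω.haar :=
    fun _ => rfl
  simp only [hslice]
  rw [intervalIntegral.integral_add ((hint hloc).intervalIntegrable a b)
      ((continuous_finsetSum _ fun i _ => hint (hinter i)).intervalIntegrable a b),
    intervalIntegral.integral_finsetSum fun i _ => (hint (hinter i)).intervalIntegrable a b,
    ← setIntegral_univ_prod_Icc hloc hab]
  simp only [← setIntegral_univ_prod_Icc (hinter _) hab]
  rfl

lemma hasDerivAt_action (hΨ : SmoothFamily Ψ) {a b : ℝ} (hab : a ≤ b) (s : ℝ) :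
    HasDerivAt (fun r => S.action (Ψ r) a b)
      (∫ t in a..b, S.sliceVar (Ψ s) (variation Ψ s) t) s := by
  simp only [fun r => S.action_eq_intervalIntegral_sliceAction (hΨ.smooth r) hab]
  exact hasDerivAt_intervalIntegral_of_continuous (f := fun r t => S.sliceAction (Ψ r) t)
    (f' := fun r t => S.sliceVar (Ψ r) (variation Ψ r) t)
    (fun r => (S.continuous_sliceAction hΨ).comp (Continuous.prodMk_right r))
    (S.continuous_sliceVar hΨ hΨ.variation) (S.hasDerivAt_sliceAction hΨ) a b s

/-- The momentum one-form: the derivative of the local Lagrangian in the clock velocities, as a real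
linear form on the fibre. -/
def momentumForm (g : M) (J : Jet C M) : Fib C →L[ℝ] ℝ :=
  fderiv ℝ (fun v : Fib C => S.locLagrangian g (J.1, J.2.1, J.2.2.1, v)) J.2.2.2

lemma momentumForm_apply (g : M) (J : Jet C M) (v : Fib C) :
    S.momentumForm g J v = fderiv ℝ (S.locLagrangian g) J (0, 0, 0, v) := by
  have hincl := (hasFDerivAt_const (𝕜 := ℝ) J.1 J.2.2.2).prodMk
    ((hasFDerivAt_const (𝕜 := ℝ) J.2.1 J.2.2.2).prodMk
      ((hasFDerivAt_const (𝕜 := ℝ) J.2.2.1 J.2.2.2).prodMk (hasFDerivAt_id (𝕜 := ℝ) J.2.2.2)))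
  exact congrArg (fun A : Fib C →L[ℝ] ℝ => A v)
    ((differentiable_fibre S.locLagrangian_contMDiff_one g J).hasFDerivAt.comp J.2.2.2 hincl).fderiv

lemma sum_momentumJet_eq_momentumForm (g : M) (J : Jet C M) (v : Fib C) :
    ∑ c, (S.momentumJet c g J * v c + S.momentumBarJet c g J * starRingEnd ℂ (v c)) =
      (S.momentumForm g J v : ℂ) := by
  classical
  exact sum_wirtinger_eq (S.momentumForm g J : Fib C →ₗ[ℝ] ℝ) v

lemma continuous_momentumForm_apply (hφ : Smooth φ) (t : ℝ) {v : M → Fib C} (hv : Continuous v) :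
    Continuous fun g => S.momentumForm g (jet φ g t) (v g) := by
  have hjet : Continuous fun g => jet φ g t :=
    hφ.continuous_jet.comp (by fun_prop : Continuous fun g : M => (g, t))
  simp only [momentumForm_apply]
  exact ((continuous_fderiv_fibre S.locLagrangian_contMDiff_one).comp
    (continuous_id.prodMk hjet)).clm_apply (by fun_prop)

lemma continuous_velDeriv (hφ : Smooth φ) (c : C) (t : ℝ) (z : ℂ) :
    Continuous fun g => S.velDeriv c g (jet φ g t) z :=
  S.continuous_momentumForm_apply hφ t continuous_const

lemma continuous_mom (hφ : Smooth φ) (c : C) (t : ℝ) : Continuous fun g => S.mom φ c g t :=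
  ((Complex.continuous_ofReal.comp (S.continuous_velDeriv hφ c t 1)).sub (continuous_const.mul
    (Complex.continuous_ofReal.comp (S.continuous_velDeriv hφ c t Complex.I)))).div_const 2

lemma continuous_momBar (hφ : Smooth φ) (c : C) (t : ℝ) : Continuous fun g => S.momBar φ c g t :=
  ((Complex.continuous_ofReal.comp (S.continuous_velDeriv hφ c t 1)).add (continuous_const.mul
    (Complex.continuous_ofReal.comp (S.continuous_velDeriv hφ c t Complex.I)))).div_const 2

/-- The pairing `∫_M ∑_c (Π^c δ^c + Π̄^c δ̄^c)` of the momenta of `φ` with the variation `δ`, on the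
slice at `t`. -/
def momentumPairing (φ δ : Field C M) (t : ℝ) : ℝ :=
  ∫ g, S.momentumForm g (jet φ g t) (val δ g t) ∂M.haar

lemma continuous_momentumPairing (hφ : Smooth φ) (hδ : Smooth δ) :
    Continuous (S.momentumPairing φ δ) := by
  have hperm : Continuous fun z : ℝ × M => (z.2, z.1) := continuous_swap
  refine continuous_integral_of_compactSpace
    (f := fun t g => S.momentumForm g (jet φ g t) (val δ g t)) ?_
  simp only [Function.uncurry_def, momentumForm_apply]
  exact ((continuous_fderiv_fibre S.locLagrangian_contMDiff_one).comp (continuous_snd.prodMk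
    (hφ.continuous_jet.comp hperm))).clm_apply (by
      have := hδ.contMDiff_val.continuous.comp hperm
      fun_prop)

lemma integral_sum_mom_eq (φ : Field C M) (v : C → M → ℂ) (t : ℝ) :
    ∫ g, ∑ c, (S.mom φ c g t * v c g + S.momBar φ c g t * starRingEnd ℂ (v c g)) ∂M.haar =
      (∫ g, S.momentumForm g (jet φ g t) (fun c => v c g) ∂M.haar : ℝ) := by
  rw [← integral_complex_ofReal]
  exact congrArg _ (funext fun g =>
    S.sum_momentumJet_eq_momentumForm g (jet φ g t) fun c => v c g)

lemma charge_eq_momentumPairing (Φ : PointFlow C M) (φ : Field C M) (t : ℝ) :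
    S.charge Φ φ t =
      (S.sliceAction φ t * Φ.clockGen t + S.momentumPairing φ (Φ.char φ) t : ℝ) := by
  rw [charge, S.integral_sum_mom_eq φ (fun c g => Φ.char φ c g t), Complex.ofReal_add]
  rfl

lemma hasDerivAt_sliceLagrangian (hφ : Smooth φ) (t : ℝ) {v : C → M → ℂ}
    (hv : ∀ c, Continuous (v c)) :
    HasDerivAt (fun s : ℝ => ((S.sliceLagrangian t (slice φ t)
        (fun c g => sliceVel φ t c g + (s : ℂ) * v c g) : ℝ) : ℂ))
      (∫ g, ∑ c, (S.mom φ c g t * v c g +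
        S.momBar φ c g t * starRingEnd ℂ (v c g)) ∂M.haar) 0 := by
  let w : M → Jet C M := fun g => (0, 0, 0, fun c => v c g)
  have hw : Continuous w := by fun_prop
  have hjet : Continuous fun g : M => jet φ g t :=
    hφ.continuous_jet.comp (by fun_prop : Continuous fun g : M => (g, t))
  have hsliceJet : ∀ (s : ℝ) (g : M), sliceJet t (slice φ t)
      (fun c g => sliceVel φ t c g + (s : ℂ) * v c g) g = jet φ g t + s • w g := fun s g => by
    simp only [jet, sliceJet, w]
    ext <;> simp
  have hloc := hasDerivAt_integral_fibre (μ := M.haar) S.locLagrangian_contMDiff_one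
    (σ := fun s g => jet φ g t + s • w g) (σ' := fun _ g => w g) (by fun_prop) (by fun_prop)
    (fun s g => by simpa using ((hasDerivAt_id s).smul_const (w g)).const_add (jet φ g t)) 0
  rw [S.integral_sum_mom_eq]
  refine HasDerivAt.ofReal_comp ?_
  simp only [sliceLagrangian, hsliceJet]
  have hzero : ∀ g, jet φ g t + (0 : ℝ) • w g = jet φ g t := fun g =>
    (congrArg (jet φ g t + ·) (zero_smul ℝ (w g))).trans (add_zero _)
  simp only [hzero] at hloc
  simp only [momentumForm_apply]
  exact hloc.add_const _

end Model

end FirstVariation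

section Charges

variable {C : Type w} {M : HaarLieGroup.{u}} {φ ψ : Field C M}

lemma jet_snd_add_eq {s t : ℝ} (h : ∀ᶠ r in 𝓝 t, ∀ c g, ψ c g (r + s) = φ c g r) (g : M) :
    (jet ψ g (t + s)).2 = (jet φ g t).2 := by
  refine Prod.ext (funext fun c => h.self_of_nhds c g)
    (Prod.ext (funext fun c => ?_) (funext fun c => ?_))
  · change leftGrad (fun g => ψ c g (t + s)) g = leftGrad (fun g => φ c g t) g
    simp only [h.self_of_nhds c]
  · change deriv (fun r => ψ c g r) (t + s) = deriv (fun r => φ c g r) t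
    rw [← deriv_comp_add_const (f := fun r => ψ c g r)]
    exact Filter.EventuallyEq.deriv_eq (h.mono fun r hr => hr c g)

variable [Fintype C]

namespace PointFlow

variable (Φ : PointFlow C M)

lemma contMDiff_base (hφ : Smooth φ) :
    ContMDiff (𝓘(ℝ, ℝ).prod (M.I.prod 𝓘(ℝ, ℝ))) M.I ∞
      (fun z : ℝ × (M × ℝ) => Φ.base z.1 z.2.1 z.2.2 (val φ z.2.1 z.2.2)) :=
  Φ.base_smooth.comp (contMDiff_fst.prodMk (contMDiff_snd.fst.prodMk
    (contMDiff_snd.snd.prodMk_space (hφ.contMDiff_val.comp contMDiff_snd))))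

lemma contMDiff_clock :
    ContMDiff (𝓘(ℝ, ℝ).prod (M.I.prod 𝓘(ℝ, ℝ))) 𝓘(ℝ, ℝ) ∞
      (fun z : ℝ × (M × ℝ) => Φ.clock z.1 z.2.2) :=
  Φ.clock_smooth.contMDiff.comp (contMDiff_fst.prodMk_space contMDiff_snd.snd)

lemma smoothFamily_fiber (hφ : Smooth φ) :
    SmoothFamily fun s c g t => Φ.fiber s g t (val φ g t) c :=
  contMDiff_pi_space.1 (Φ.fiber_smooth.comp (contMDiff_fst.prodMk (contMDiff_snd.fst.prodMk
    (contMDiff_snd.snd.prodMk_space (hφ.contMDiff_val.comp contMDiff_snd)))))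

lemma smoothFamily_comp_baseMap (hφ : Smooth φ) :
    SmoothFamily fun s c g t => φ c (Φ.base s g t (val φ g t)) (Φ.clock s t) :=
  fun c => (hφ c).comp ((Φ.contMDiff_base hφ).prodMk Φ.contMDiff_clock)

lemma smooth_lieDeriv (hφ : Smooth φ) : Smooth fun c => Φ.lieDeriv φ (φ c) :=
  (Φ.smoothFamily_comp_baseMap hφ).variation.smooth 0

lemma smooth_char (hφ : Smooth φ) : Smooth (Φ.char φ) := fun c =>
  ((Φ.smoothFamily_fiber hφ).variation.smooth 0 c).sub (Φ.smooth_lieDeriv hφ c)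

lemma lieDeriv_conj (φ : Field C M) (q : M → ℝ → ℂ) (g : M) (t : ℝ) :
    Φ.lieDeriv φ (fun h r => starRingEnd ℂ (q h r)) g t = starRingEnd ℂ (Φ.lieDeriv φ q g t) :=
  deriv.star

variable {Φ}

lemma IsPureBase.char_eq (hΦ : Φ.IsPureBase) (φ : Field C M) (c : C) (g : M) (t : ℝ) :
    Φ.char φ c g t = -Φ.lieDeriv φ (φ c) g t := by
  simp [char, fiberGen, hΦ.2]

lemma IsPureBase.clockGen_eq_zero (hΦ : Φ.IsPureBase) (t : ℝ) : Φ.clockGen t = 0 := by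
  simp [clockGen, hΦ.1]

end PointFlow

lemma phaseFlow_clockGen (θ : C → ℝ) (t : ℝ) : (phaseFlow M θ).clockGen t = 0 := by
  simp [PointFlow.clockGen, phaseFlow]

lemma phaseFlow_char (θ : C → ℝ) (φ : Field C M) (c : C) (g : M) (t : ℝ) :
    (phaseFlow M θ).char φ c g t = Complex.I * θ c * φ c g t := by
  have h : HasDerivAt (fun s : ℝ => Complex.exp (Complex.I * s * θ c) * φ c g t)
      (Complex.I * θ c * φ c g t) 0 := by
    simpa using ((((hasDerivAt_id (0 : ℝ)).ofReal_comp.const_mul Complex.I).mul_const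
      (θ c : ℂ)).cexp).mul_const (φ c g t)
  simp only [PointFlow.char, PointFlow.fiberGen, PointFlow.lieDeriv, phaseFlow, deriv_const,
    sub_zero]
  exact h.deriv

lemma translationFlow_clockGen (t : ℝ) : (translationFlow C M).clockGen t = 1 := by
  simp [PointFlow.clockGen, translationFlow]

lemma translationFlow_char (φ : Field C M) (c : C) (g : M) (t : ℝ) :
    (translationFlow C M).char φ c g t = -deriv (fun r => φ c g r) t := by
  simp only [PointFlow.char, PointFlow.fiberGen, PointFlow.lieDeriv, translationFlow,
    deriv_const, zero_sub]
  rw [deriv_comp_const_add (f := fun r => φ c g r), add_zero]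

namespace Model

variable (S : Model C M)

theorem charge_phaseFlow (θ : C → ℝ) (hφ : Smooth φ) (t : ℝ) :
    S.charge (phaseFlow M θ) φ t =
      Complex.I * ∑ c, (θ c : ℂ) * ∫ g, (φ c g t * S.mom φ c g t -
        starRingEnd ℂ (φ c g t) * S.momBar φ c g t) ∂M.haar := by
  have hint : ∀ c, Integrable (fun g => φ c g t * S.mom φ c g t -
      starRingEnd ℂ (φ c g t) * S.momBar φ c g t) M.haar := fun c => by
    have hφc := (hφ.contMDiff_slice c t).continuous
    exact (((hφc.mul (S.continuous_mom hφ c t)).sub ((Complex.continuous_conj.comp hφc).mul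
      (S.continuous_momBar hφ c t)))).integrable_of_hasCompactSupport (.of_compactSpace _)
  simp only [charge, phaseFlow_clockGen, phaseFlow_char, mul_zero, Complex.ofReal_zero, zero_add]
  rw [Finset.mul_sum]
  simp only [← integral_const_mul]
  rw [← integral_finsetSum _ fun c _ => ((hint c).const_mul _).const_mul _]
  refine integral_congr_ae (.of_forall fun g => Finset.sum_congr rfl fun c _ => ?_)
  simp only [map_mul, Complex.conj_I, Complex.conj_ofReal]
  ring

theorem charge_of_isPureBase {Φ : PointFlow C M} (hΦ : Φ.IsPureBase) (hφ : Smooth φ) (t : ℝ) :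
    S.charge Φ φ t =
      -(∫ g, ∑ c, S.mom φ c g t * Φ.lieDeriv φ (φ c) g t ∂M.haar) -
        ∫ g, ∑ c, S.momBar φ c g t *
          Φ.lieDeriv φ (fun h r => starRingEnd ℂ (φ c h r)) g t ∂M.haar := by
  have hlie : ∀ c, Continuous fun g => Φ.lieDeriv φ (φ c) g t := fun c =>
    ((Φ.smooth_lieDeriv hφ).contMDiff_slice c t).continuous
  have hmom : Integrable (fun g => -∑ c, S.mom φ c g t * Φ.lieDeriv φ (φ c) g t) M.haar :=
    (continuous_finsetSum _ fun c _ => (S.continuous_mom hφ c t).mul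
      (hlie c)).neg.integrable_of_hasCompactSupport (.of_compactSpace _)
  have hmomBar : Integrable (fun g => ∑ c, S.momBar φ c g t *
      starRingEnd ℂ (Φ.lieDeriv φ (φ c) g t)) M.haar :=
    (continuous_finsetSum _ fun c _ => (S.continuous_momBar hφ c t).mul
      (Complex.continuous_conj.comp (hlie c))).integrable_of_hasCompactSupport (.of_compactSpace _)
  simp only [charge, hΦ.clockGen_eq_zero, hΦ.char_eq, mul_zero, Complex.ofReal_zero, zero_add,
    Φ.lieDeriv_conj]
  rw [← integral_neg, ← integral_sub hmom hmomBar]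
  refine integral_congr_ae (.of_forall fun g => ?_)
  simp only [map_neg, mul_neg, Finset.sum_add_distrib, Finset.sum_neg_distrib]
  ring

theorem charge_translationFlow (φ : Field C M) (t : ℝ) :
    S.charge (translationFlow C M) φ t =
      -(∫ g, ∑ c, (S.mom φ c g t * deriv (fun r => φ c g r) t +
        S.momBar φ c g t * deriv (fun r => starRingEnd ℂ (φ c g r)) t) ∂M.haar) +
      (S.sliceAction φ t : ℂ) := by
  have hconj : ∀ c g, deriv (fun r => starRingEnd ℂ (φ c g r)) t =
      starRingEnd ℂ (deriv (fun r => φ c g r) t) := fun _ _ => deriv.star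
  simp only [charge, translationFlow_clockGen, translationFlow_char, hconj, mul_one]
  rw [add_comm, ← integral_neg]
  congr 1
  refine integral_congr_ae (.of_forall fun g => ?_)
  simp only [map_neg, mul_neg, ← Finset.sum_neg_distrib]
  exact Finset.sum_congr rfl fun c _ => by ring

end Model

theorem Model.isSymmetry_translationFlow (S : Model C M) (hS : S.ClockIndependent) :
    S.IsSymmetry (translationFlow C M) where
  preserves s J _ φ ψ hφ _ hT k hk c g t ht := by
    have hψ : ∀ g, ψ c g (t + s) = φ c g t := fun g => hT g t ht c
    change ψ c (k g) (t + s) = ψ c g (t + s)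
    rw [hψ, hψ, hφ.2 k hk]
  loc s J hJ φ ψ _ _ hT A hA hAJ := by
    refine (setIntegral_image_add_right_snd (fun p => S.locLagrangian p.1 (jet ψ p.1 p.2)) s
      A).trans (setIntegral_congr_fun hA.measurableSet fun p hp => ?_)
    have hψ : ∀ᶠ r in 𝓝 p.2, ∀ c g, ψ c g (r + s) = φ c g r :=
      (hJ.eventually_mem (hAJ hp).2).mono fun r hr c g => hT g r hr c
    exact (hS.1 p.1 (p.2 + s) p.2 _ _ _).trans
      (congrArg (fun y => S.locLagrangian p.1 (p.2, y)) (jet_snd_add_eq hψ p.1))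
  inter i := by
    refine ⟨fun _ x _ _ => x, ⟨contMDiff_snd.fst, fun _ _ _ => rfl, fun _ _ _ _ _ => rfl,
      fun _ _ _ _ _ => rfl⟩, fun s J _ φ ψ _ _ hT A hA hAJ => ?_⟩
    refine (setIntegral_image_add_right_snd (fun p => (S.inter i).lagrangian p.1
      (p.2, (S.inter i).legVals ψ p.1 p.2)) s A).trans
        (setIntegral_congr_fun hA.measurableSet fun p hp => ?_)
    have hlegs : (S.inter i).legVals ψ p.1 (p.2 + s) = (S.inter i).legVals φ p.1 p.2 :=
      funext fun j => funext fun c => hT ((S.inter i).legs j p.1) p.2 (hAJ hp).2 c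
    simp only [hlegs]
    exact hS.2 i p.1 _ _ _

end Charges

section LocalTransforms

open Metric

variable {C : Type w} {M : HaarLieGroup.{u}} {φ ψ ψ' : Field C M}

/-- Interpolation between a field and the members of a family of fields, with weight `χ` depending
on the parameter and on the clock variable; it turns transforms that exist locally into a globally
defined family. -/
def blend (χ : ℝ × ℝ → ℝ) (φ : Field C M) (Ψ : ℝ → Field C M) : ℝ → Field C M :=
  fun s c g t => φ c g t + χ (s, t) • (Ψ s c g t - φ c g t)

lemma blend_of_eq_one {χ : ℝ × ℝ → ℝ} (Ψ : ℝ → Field C M) {s t : ℝ} (h : χ (s, t) = 1) (c : C)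
    (g : M) : blend χ φ Ψ s c g t = Ψ s c g t := by
  simp [blend, h]

lemma blend_of_eq_zero {χ : ℝ × ℝ → ℝ} (Ψ : ℝ → Field C M) {s t : ℝ} (h : χ (s, t) = 0) (c : C)
    (g : M) : blend χ φ Ψ s c g t = φ c g t := by
  simp [blend, h]

lemma blend_of_eq (χ : ℝ × ℝ → ℝ) {Ψ : ℝ → Field C M} {s t : ℝ} {c : C} {g : M}
    (h : Ψ s c g t = φ c g t) : blend χ φ Ψ s c g t = φ c g t := by
  simp [blend, h]

lemma smoothFamily_blend (hφ : Smooth φ) {χ : ℝ × ℝ → ℝ} (hχ : ContDiff ℝ ∞ χ) {V : Set (ℝ × ℝ)}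
    (hV : IsOpen V) (hχV : tsupport χ ⊆ V) {Ψ : ℝ → Field C M}
    (hΨ : ∀ c, ContMDiffOn (𝓘(ℝ, ℝ).prod (M.I.prod 𝓘(ℝ, ℝ))) 𝓘(ℝ, ℂ) ∞
      (fun z : ℝ × (M × ℝ) => Ψ z.1 c z.2.1 z.2.2) {z | (z.1, z.2.2) ∈ V}) :
    SmoothFamily (blend χ φ Ψ) := fun c => by
  have hφc : ContMDiff (𝓘(ℝ, ℝ).prod (M.I.prod 𝓘(ℝ, ℝ))) 𝓘(ℝ, ℂ) ∞
      fun z : ℝ × (M × ℝ) => φ c z.2.1 z.2.2 := hφ.const_family c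
  have hπ : Continuous fun z : ℝ × (M × ℝ) => (z.1, z.2.2) := by fun_prop
  refine hφc.add (contMDiff_smul_of_tsupport_subset (hV.preimage hπ)
    (hχ.contMDiff.comp (contMDiff_fst.prodMk_space contMDiff_snd.snd))
    ((hΨ c).sub hφc.contMDiffOn) ?_)
  exact (tsupport_comp_subset_preimage χ hπ).trans (preimage_mono hχV)

variable [Fintype C]

namespace PointFlow

variable (Φ : PointFlow C M)

lemma clock_neg_clock (s t : ℝ) : Φ.clock (-s) (Φ.clock s t) = t := by
  rw [← Φ.clock_add, neg_add_cancel, Φ.clock_zero]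

lemma clock_clock_neg (s t : ℝ) : Φ.clock s (Φ.clock (-s) t) = t := by
  rw [← Φ.clock_add, add_neg_cancel, Φ.clock_zero]

lemma clock_strictMono (s : ℝ) : StrictMono (Φ.clock s) := fun a b hab => by
  by_contra! h
  have hcont : Continuous fun r => Φ.clock r b - Φ.clock r a :=
    (Φ.clock_smooth.continuous.comp (.prodMk_left b)).sub
      (Φ.clock_smooth.continuous.comp (.prodMk_left a))
  obtain ⟨r, hr⟩ := mem_range_of_exists_le_of_exists_ge hcont (c := 0) ⟨s, sub_nonpos.2 h⟩
    ⟨0, by simpa only [Φ.clock_zero] using sub_nonneg.2 hab.le⟩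
  have hba := congrArg (Φ.clock (-r)) (sub_eq_zero.1 hr)
  rw [Φ.clock_neg_clock, Φ.clock_neg_clock] at hba
  exact hab.ne' hba

/-- The reparametrisation of the clock variable by a point transformation. -/
def clockOrderIso (s : ℝ) : ℝ ≃o ℝ :=
  (Φ.clock_strictMono s).orderIsoOfRightInverse (Φ.clock s) (Φ.clock (-s)) (Φ.clock_clock_neg s)

lemma clock_image_Icc (s a b : ℝ) :
    Φ.clock s '' Icc a b = Icc (Φ.clock s a) (Φ.clock s b) :=
  (Φ.clockOrderIso s).image_Icc a b

lemma hasDerivAt_clock (t : ℝ) : HasDerivAt (fun s => Φ.clock s t) (Φ.clockGen t) 0 :=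
  ((Φ.clock_smooth.comp (contDiff_id.prodMk contDiff_const)).differentiable (by simp)
    0).hasDerivAt

lemma eventually_clock_mem_Ioo {R R' : ℝ} (h : R < R') :
    ∀ᶠ s in 𝓝 (0 : ℝ), ∀ t ∈ Icc (-R) R, Φ.clock s t ∈ Ioo (-R') R' :=
  isCompact_Icc.eventually_forall_of_forall_eventually fun t ht =>
    Φ.clock_smooth.continuous.continuousAt.eventually_mem (isOpen_Ioo.mem_nhds (by
      rw [Φ.clock_zero]
      exact Icc_subset_Ioo (neg_lt_neg h) h ht))

lemma base_neg_base (s : ℝ) (g : M) (t : ℝ) (u : Fib C) :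
    Φ.base (-s) (Φ.base s g t u) (Φ.clock s t) (Φ.fiber s g t u) = g := by
  rw [← Φ.base_add, neg_add_cancel, Φ.base_zero]

lemma base_base_neg (s : ℝ) (g : M) (t : ℝ) (u : Fib C) :
    Φ.base s (Φ.base (-s) g t u) (Φ.clock (-s) t) (Φ.fiber (-s) g t u) = g := by
  rw [← Φ.base_add, add_neg_cancel, Φ.base_zero]

lemma fiber_neg_fiber (s : ℝ) (g : M) (t : ℝ) (u : Fib C) :
    Φ.fiber (-s) (Φ.base s g t u) (Φ.clock s t) (Φ.fiber s g t u) = u := by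
  rw [← Φ.fiber_add, neg_add_cancel, Φ.fiber_zero]

/-- `ψ` is the transform of `φ` over the clock values in `J`, and conversely `φ` is the transform of
`ψ` back: the graph of `φ` over `M × J` is mapped onto the whole graph of `ψ` over the image of
`J`. -/
structure MapsGraphOnto (s : ℝ) (J : Set ℝ) (φ ψ : Field C M) : Prop where
  transforms : Φ.Transforms s J φ ψ
  symm : Φ.Transforms (-s) (Φ.clock s '' J) ψ φ

/-- The map of the fibre at `(g, t)` whose fixed points are the `u` for which the transformation
with parameter `-s` moves `(g, t, u)` into the graph of `φ`. -/
def pull (φ : Field C M) (p : ℝ × (M × ℝ)) (u : Fib C) : Fib C :=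
  u - (Φ.fiber (-p.1) p.2.1 p.2.2 u -
    val φ (Φ.base (-p.1) p.2.1 p.2.2 u) (Φ.clock (-p.1) p.2.2))

lemma pull_zero (φ : Field C M) (y : M × ℝ) (u : Fib C) :
    Φ.pull φ (0, y) u = val φ y.1 y.2 := by
  simp [pull, Φ.fiber_zero, Φ.base_zero, Φ.clock_zero]

lemma pull_eq_self_iff (φ : Field C M) (s : ℝ) (g : M) (t : ℝ) (u : Fib C) :
    Φ.pull φ (s, (g, t)) u = u ↔
      val φ (Φ.base (-s) g t u) (Φ.clock (-s) t) = Φ.fiber (-s) g t u := by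
  rw [pull, sub_eq_self, sub_eq_zero, eq_comm]

lemma contMDiff_pull (hφ : Smooth φ) :
    ContMDiff ((𝓘(ℝ, ℝ).prod (M.I.prod 𝓘(ℝ, ℝ))).prod 𝓘(ℝ, Fib C)) 𝓘(ℝ, Fib C) ∞
      (Function.uncurry (Φ.pull φ)) := by
  have hs : ContMDiff ((𝓘(ℝ, ℝ).prod (M.I.prod 𝓘(ℝ, ℝ))).prod 𝓘(ℝ, Fib C)) 𝓘(ℝ, ℝ) ∞
      (fun q : (ℝ × (M × ℝ)) × Fib C => -q.1.1) := contMDiff_fst.fst.neg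
  have ht : ContMDiff ((𝓘(ℝ, ℝ).prod (M.I.prod 𝓘(ℝ, ℝ))).prod 𝓘(ℝ, Fib C)) 𝓘(ℝ, ℝ) ∞
      (fun q : (ℝ × (M × ℝ)) × Fib C => q.1.2.2) := contMDiff_fst.snd.snd
  have harg := hs.prodMk (contMDiff_fst.snd.fst.prodMk (ht.prodMk_space contMDiff_snd))
  exact contMDiff_snd.sub ((Φ.fiber_smooth.comp harg).sub (hφ.contMDiff_val.comp
    ((Φ.base_smooth.comp harg).prodMk (Φ.clock_smooth.contMDiff.comp (hs.prodMk_space ht)))))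

lemma eventually_pull_contracts (hφ : Smooth φ) {K : Set (M × ℝ)} (hK : IsCompact K) {B : ℝ}
    (hB : ∀ y ∈ K, ‖val φ y.1 y.2‖ < B) :
    ∀ᶠ s in 𝓝 (0 : ℝ), ∀ y ∈ K, ∀ u ∈ closedBall (0 : Fib C) B,
      ‖fderiv ℝ (Φ.pull φ (s, y)) u‖ < 1 / 2 ∧ ‖Φ.pull φ (s, y) u‖ < B := by
  have hpull := Φ.contMDiff_pull hφ
  have hfderiv : Continuous fun q : (ℝ × (M × ℝ)) × Fib C => fderiv ℝ (Φ.pull φ q.1) q.2 :=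
    ContMDiff.continuous (I := (𝓘(ℝ, ℝ).prod (M.I.prod 𝓘(ℝ, ℝ))).prod 𝓘(ℝ, Fib C))
      (I' := 𝓘(ℝ, Fib C →L[ℝ] Fib C)) (n := ∞) fun q =>
        contMDiffAt_fderiv_param (f := fun q : (ℝ × (M × ℝ)) × Fib C => Φ.pull φ q.1)
          (ContMDiffAt.comp (q, q.2) (hpull (q.1, q.2))
            (contMDiffAt_fst.fst.prodMk contMDiffAt_snd)) contMDiffAt_snd (by simp)
  have hassoc : Continuous fun z : ℝ × ((M × ℝ) × Fib C) => ((z.1, z.2.1), z.2.2) := by fun_prop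
  refine ((hK.prod (isCompact_closedBall (0 : Fib C) B)).eventually_forall_of_forall_eventually
    (P := fun s y => ‖fderiv ℝ (Φ.pull φ (s, y.1)) y.2‖ < 1 / 2 ∧ ‖Φ.pull φ (s, y.1) y.2‖ < B)
    fun y hy => ?_).mono fun s hs y hy u hu => hs (y, u) ⟨hy, hu⟩
  refine ((hfderiv.comp hassoc).norm.continuousAt.eventually_lt continuousAt_const ?_).and
    ((hpull.continuous.comp hassoc).norm.continuousAt.eventually_lt continuousAt_const ?_)
  · have hconst : Φ.pull φ (0, y.1) = fun _ => val φ y.1.1 y.1.2 := funext (Φ.pull_zero φ y.1)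
    simp [hconst]
  · simpa [Φ.pull_zero] using hB y.1 hy.1

lemma exists_local_transforms (hφ : Smooth φ) {R B : ℝ} (hB0 : 0 ≤ B)
    (hB : ∀ g, ∀ t ∈ Icc (-R) R, ‖val φ g t‖ < B) :
    ∃ ε > 0, ∃ v : ℝ → Field C M,
      (∀ c, ContMDiffOn (𝓘(ℝ, ℝ).prod (M.I.prod 𝓘(ℝ, ℝ))) 𝓘(ℝ, ℂ) ∞
        (fun z : ℝ × (M × ℝ) => v z.1 c z.2.1 z.2.2)
        {z | (z.1, z.2.2) ∈ Ioo (-ε) ε ×ˢ Ioo (-R) R}) ∧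
      ∀ s ∈ Ioo (-ε) ε, ∀ g, ∀ t ∈ Ioo (-R) R, val (v s) g t ∈ ball 0 B ∧
        ∀ u ∈ closedBall 0 B, val φ (Φ.base (-s) g t u) (Φ.clock (-s) t) = Φ.fiber (-s) g t u ↔
          u = val (v s) g t := by
  obtain ⟨ε, hε, hcontr⟩ := Metric.eventually_nhds_iff.1 (Φ.eventually_pull_contracts hφ
    ((isCompact_univ (X := M)).prod (isCompact_Icc (a := -R) (b := R))) fun y hy => hB y.1 y.2 hy.2)
  let U : Set (ℝ × (M × ℝ)) := {z | (z.1, z.2.2) ∈ Ioo (-ε) ε ×ˢ Ioo (-R) R}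
  have hU : IsOpen U := (isOpen_Ioo.prod isOpen_Ioo).preimage
    (by fun_prop : Continuous fun z : ℝ × (M × ℝ) => (z.1, z.2.2))
  have hcontrU : ∀ p ∈ U, ∀ u ∈ closedBall (0 : Fib C) B,
      ‖fderiv ℝ (Φ.pull φ p) u‖ < 1 / 2 ∧ ‖Φ.pull φ p u‖ < B := fun p hp u hu =>
    hcontr (y := p.1) (by simpa [abs_lt] using hp.1) p.2 ⟨mem_univ _, Ioo_subset_Icc_self hp.2⟩ u hu
  obtain ⟨v, hv, hfix⟩ := exists_contMDiffOn_fixedPoint (K := 1 / 2) (by simp) hU hB0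
    (by simpa using NNReal.half_lt_self one_ne_zero) (Φ.contMDiff_pull hφ).contMDiffOn
    (fun p hp u hu => by
      simpa [← NNReal.coe_le_coe] using (hcontrU p hp u hu).1.le)
    (fun p hp u hu => by simpa using (hcontrU p hp u hu).2)
  refine ⟨ε, hε, fun s c g t => v (s, (g, t)) c, fun c => contMDiffOn_pi_space.1 hv c,
    fun s hs g t ht => ⟨(hfix (s, (g, t)) ⟨hs, ht⟩).1, fun u hu => ?_⟩⟩
  rw [← Φ.pull_eq_self_iff]
  exact (hfix (s, (g, t)) ⟨hs, ht⟩).2 u hu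

end PointFlow

end LocalTransforms

section SymmetryTransforms

open Metric

variable {C : Type w} [Fintype C] {M : HaarLieGroup.{u}} {φ ψ ψ' : Field C M}

namespace PointFlow

variable {Φ : PointFlow C M}

lemma MapsGraphOnto.congr_of_subset {s : ℝ} {J J' : Set ℝ} (h : Φ.MapsGraphOnto s J φ ψ)
    (hJ : J' ⊆ J) (hψ : ∀ t ∈ J', ∀ c g, ψ' c g (Φ.clock s t) = ψ c g (Φ.clock s t)) :
    Φ.MapsGraphOnto s J' φ ψ' where
  transforms g t ht c := (hψ t ht c _).trans (h.transforms g t (hJ ht) c)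
  symm := by
    rintro g _ ⟨t, ht, rfl⟩ c
    rw [show val ψ' g (Φ.clock s t) = val ψ g (Φ.clock s t) from funext fun c => hψ t ht c g]
    exact h.symm g _ ⟨t, hJ ht, rfl⟩ c

lemma MapsGraphOnto.val_base_neg {s t : ℝ} {J : Set ℝ} (h : Φ.MapsGraphOnto s J φ ψ) (ht : t ∈ J)
    (g : M) :
    val φ (Φ.base (-s) g (Φ.clock s t) (val ψ g (Φ.clock s t))) t =
      Φ.fiber (-s) g (Φ.clock s t) (val ψ g (Φ.clock s t)) := by
  have hg := funext (h.symm g (Φ.clock s t) ⟨t, ht, rfl⟩)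
  rwa [Φ.clock_neg_clock] at hg

lemma MapsGraphOnto.image_prod {s : ℝ} {J A : Set ℝ} (h : Φ.MapsGraphOnto s J φ ψ) (hA : A ⊆ J) :
    (fun p : M × ℝ => (Φ.base s p.1 p.2 (val φ p.1 p.2), Φ.clock s p.2)) '' (univ ×ˢ A) =
      univ ×ˢ (Φ.clock s '' A) := by
  refine image_univ_prod_of_surjective
    (k := fun g t => Φ.base s g t (val φ g t)) fun t ht g => ?_
  refine ⟨Φ.base (-s) g (Φ.clock s t) (val ψ g (Φ.clock s t)), ?_⟩
  have hinv := Φ.base_base_neg s g (Φ.clock s t) (val ψ g (Φ.clock s t))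
  rwa [Φ.clock_neg_clock, ← h.val_base_neg (hA ht)] at hinv

lemma mapsGraphOnto_of_forall_iff {s : ℝ} {J : Set ℝ} {D : Set (Fib C)}
    (hψ : ∀ g, ∀ t ∈ Φ.clock s '' J, val ψ g t ∈ D ∧ ∀ u ∈ D,
      val φ (Φ.base (-s) g t u) (Φ.clock (-s) t) = Φ.fiber (-s) g t u ↔ u = val ψ g t)
    (hφ : ∀ g, ∀ t ∈ J, Φ.fiber s g t (val φ g t) ∈ D) : Φ.MapsGraphOnto s J φ ψ where
  transforms g t ht c := by
    refine congrFun (((hψ _ _ ⟨t, ht, rfl⟩).2 _ (hφ g t ht)).1 ?_).symm c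
    rw [Φ.base_neg_base, Φ.clock_neg_clock, Φ.fiber_neg_fiber]
  symm g t ht c := congrFun (((hψ g t ht).2 _ (hψ g t ht).1).2 rfl) c

variable (Φ)

lemma eventually_norm_fiber_lt (hφ : Smooth φ) {K : Set (M × ℝ)} (hK : IsCompact K) {B : ℝ}
    (hB : ∀ y ∈ K, ‖val φ y.1 y.2‖ < B) :
    ∀ᶠ s in 𝓝 (0 : ℝ), ∀ y ∈ K, ‖Φ.fiber s y.1 y.2 (val φ y.1 y.2)‖ < B := by
  have hcont : Continuous fun z : ℝ × (M × ℝ) =>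
      ‖Φ.fiber z.1 z.2.1 z.2.2 (val φ z.2.1 z.2.2)‖ :=
    (continuous_pi fun c => (Φ.smoothFamily_fiber hφ c).continuous).norm
  exact hK.eventually_forall_of_forall_eventually fun y hy =>
    hcont.continuousAt.eventually_lt continuousAt_const
      (by simpa only [Φ.fiber_zero] using hB y hy)

lemma exists_smoothFamily_mapsGraphOnto (hφ : Smooth φ) (R : ℝ) :
    ∃ Ψ : ℝ → Field C M, SmoothFamily Ψ ∧ Ψ 0 = φ ∧
      ∀ᶠ s in 𝓝 (0 : ℝ), Φ.MapsGraphOnto s (Ioo (-R) R) φ (Ψ s) := by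
  obtain ⟨B, hB0, hB⟩ : ∃ B, 0 ≤ B ∧ ∀ g, ∀ t ∈ Icc (-(R + 2)) (R + 2), ‖val φ g t‖ < B := by
    obtain ⟨B, hB0, hB⟩ := (((isCompact_univ (X := M)).prod isCompact_Icc).image
      hφ.contMDiff_val.continuous).isBounded.exists_pos_norm_lt
    exact ⟨B, hB0.le, fun g t ht => hB _ ⟨(g, t), ⟨mem_univ g, ht⟩, rfl⟩⟩
  obtain ⟨ε, hε, v, hv, hfix⟩ := Φ.exists_local_transforms hφ hB0 hB
  have hR : R + 1 < R + 2 := by linarith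
  obtain ⟨χ, hχ, hχ1, hχV⟩ := exists_contDiff_eqOn_one_tsupport_subset
    (isClosed_Icc.prod isClosed_Icc) (isOpen_Ioo.prod isOpen_Ioo)
    (prod_mono (Icc_subset_Ioo (neg_lt_neg (half_lt_self hε)) (half_lt_self hε))
      (Icc_subset_Ioo (neg_lt_neg hR) hR))
  refine ⟨blend χ φ v, smoothFamily_blend hφ hχ (isOpen_Ioo.prod isOpen_Ioo) hχV hv, ?_, ?_⟩
  · funext c g t
    by_cases ht : t ∈ Ioo (-(R + 2)) (R + 2)
    · have hφB : val φ g t ∈ closedBall 0 B := by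
        simpa using (hB g t (Ioo_subset_Icc_self ht)).le
      have hv0 := ((hfix 0 (by simpa using hε) g t ht).2 _ hφB).1 (by
        simp only [neg_zero, Φ.base_zero, Φ.clock_zero, Φ.fiber_zero])
      exact blend_of_eq χ (congrFun hv0 c).symm
    · exact blend_of_eq_zero v (image_eq_zero_of_notMem_tsupport fun h => ht (hχV h).2) c g
  have hfiber := Φ.eventually_norm_fiber_lt hφ
    ((isCompact_univ (X := M)).prod (isCompact_Icc (a := -R) (b := R))) fun y hy =>
      hB y.1 y.2 (Icc_subset_Icc (by linarith) (by linarith) hy.2)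
  filter_upwards [Icc_mem_nhds (neg_lt_zero.2 (half_pos hε)) (half_pos hε),
    Φ.eventually_clock_mem_Ioo (lt_add_one R), hfiber] with s hs hclock hfib
  have hsε : s ∈ Ioo (-ε) ε := ⟨by linarith [hs.1], by linarith [hs.2]⟩
  have hclock' : ∀ t ∈ Ioo (-R) R, Φ.clock s t ∈ Ioo (-(R + 1)) (R + 1) := fun t ht =>
    hclock t (Ioo_subset_Icc_self ht)
  have hvs : Φ.MapsGraphOnto s (Ioo (-R) R) φ (v s) := by
    refine mapsGraphOnto_of_forall_iff (D := closedBall 0 B) ?_ fun g t ht => by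
      simpa using (hfib (g, t) ⟨mem_univ g, Ioo_subset_Icc_self ht⟩).le
    rintro g _ ⟨t, ht, rfl⟩
    exact (hfix s hsε g _ (Ioo_subset_Ioo (neg_le_neg hR.le) hR.le (hclock' t ht))).imp_left
      fun h => ball_subset_closedBall h
  exact hvs.congr_of_subset subset_rfl fun t ht =>
    blend_of_eq_one v (hχ1 ⟨hs, Ioo_subset_Icc_self (hclock' t ht)⟩)

lemma variation_eq_char {Ψ : ℝ → Field C M} (hΨ : SmoothFamily Ψ) (h0 : Ψ 0 = φ) {J : Set ℝ}
    (hT : ∀ᶠ s in 𝓝 (0 : ℝ), Φ.Transforms s J φ (Ψ s)) (c : C) (g : M) {t : ℝ} (ht : t ∈ J) :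
    variation Ψ 0 c g t = Φ.char φ c g t := by
  let f : ℝ → ℝ → ℂ := fun r s => Ψ r c (Φ.base s g t (val φ g t)) (Φ.clock s t)
  have hf : DifferentiableAt ℝ (Function.uncurry f) (0, 0) := by
    have hs : ContMDiff 𝓘(ℝ, ℝ × ℝ) (𝓘(ℝ, ℝ).prod (M.I.prod 𝓘(ℝ, ℝ))) ∞
        fun p : ℝ × ℝ => (p.2, (g, t)) := contDiff_snd.contMDiff.prodMk contMDiff_const
    exact ((hΨ c).comp (contDiff_fst.contMDiff.prodMk
      (((Φ.contMDiff_base (h0 ▸ hΨ.smooth 0)).comp hs).prodMk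
        (Φ.contMDiff_clock.comp hs)))).contDiff.differentiable (by simp) (0, 0)
  have hfiber : Φ.fiberGen φ c g t = deriv (fun s => f s s) 0 :=
    Filter.EventuallyEq.deriv_eq (hT.mono fun s hs => (hs g t ht c).symm)
  rw [char, hfiber, deriv_diagonal hf]
  simp only [f, Φ.base_zero, Φ.clock_zero, h0, variation, lieDeriv, add_sub_cancel_right]

end PointFlow

namespace Model

variable {S : Model C M} {Φ : PointFlow C M}

namespace IsSymmetry

lemma exists_smoothFamily_admissible (hS : S.IsSymmetry Φ) (hφ : S.Admissible φ) (R : ℝ) :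
    ∃ Ψ : ℝ → Field C M, SmoothFamily Ψ ∧ Ψ 0 = φ ∧
      ∀ᶠ s in 𝓝 (0 : ℝ), S.Admissible (Ψ s) ∧ Φ.MapsGraphOnto s (Ioo (-R) R) φ (Ψ s) := by
  obtain ⟨Ξ, hΞ, hΞ0, hmaps⟩ := Φ.exists_smoothFamily_mapsGraphOnto hφ.1 (R + 3)
  have hR : R + 1 < R + 2 := by linarith
  obtain ⟨l, hl, hl1, hlV⟩ := exists_contDiff_eqOn_one_tsupport_subset isClosed_Icc isOpen_Ioo
    (Icc_subset_Ioo (neg_lt_neg hR) hR)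
  let χ : ℝ × ℝ → ℝ := fun p => l p.2
  have hblend : SmoothFamily (blend χ φ Ξ) := smoothFamily_blend hφ.1 (hl.comp contDiff_snd)
    isOpen_univ (subset_univ _) fun c => (hΞ c).contMDiffOn
  refine ⟨blend χ φ Ξ, hblend, ?_, ?_⟩
  · funext c g t
    exact blend_of_eq χ (by rw [hΞ0])
  filter_upwards [hmaps, Φ.eventually_clock_mem_Ioo (lt_add_one R),
    (continuous_neg.tendsto' 0 0 neg_zero).eventually
      (Φ.eventually_clock_mem_Ioo (by linarith : R + 2 < R + 3))] with s hs hclock hclock'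
  refine ⟨⟨hblend.smooth s, fun k hk c g t => ?_⟩, hs.congr_of_subset
    (Ioo_subset_Ioo (by linarith) (by linarith)) fun t ht =>
      blend_of_eq_one Ξ (hl1 (Ioo_subset_Icc_self (hclock t (Ioo_subset_Icc_self ht))))⟩
  by_cases ht : t ∈ Icc (-(R + 2)) (R + 2)
  · have hΞk := hS.preserves s _ isOpen_Ioo φ (Ξ s) hφ (hΞ.smooth s) hs.transforms k hk c g
      (Φ.clock (-s) t) (hclock' t ht)
    rw [Φ.clock_clock_neg] at hΞk
    simp only [blend, hΞk, hφ.2 k hk]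
  · have hlt : l t = 0 := image_eq_zero_of_notMem_tsupport fun h =>
      ht (Ioo_subset_Icc_self (hlV h))
    rw [blend_of_eq_zero Ξ hlt, blend_of_eq_zero Ξ hlt, hφ.2 k hk]

lemma admissible_char (hS : S.IsSymmetry Φ) (hφ : S.Admissible φ) : S.Admissible (Φ.char φ) := by
  refine ⟨Φ.smooth_char hφ.1, fun k hk c g t => ?_⟩
  obtain ⟨Ψ, hΨ, hΨ0, hev⟩ := hS.exists_smoothFamily_admissible hφ (|t| + 1)
  have hchar : ∀ g, variation Ψ 0 c g t = Φ.char φ c g t := fun g =>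
    Φ.variation_eq_char hΨ hΨ0 (hev.mono fun s hs => hs.2.transforms) c g
      (abs_lt.1 (lt_add_one |t|))
  rw [← hchar, ← hchar]
  exact Filter.EventuallyEq.deriv_eq (hev.mono fun s hs => hs.1.2 k hk c g t)

lemma action_eq (hS : S.IsSymmetry Φ) {s : ℝ} {J : Set ℝ} (hJ : IsOpen J)
    (hφ : S.Admissible φ) (hψ : S.Admissible ψ) (h : Φ.MapsGraphOnto s J φ ψ) {a b : ℝ}
    (hab : Icc a b ⊆ J) : S.action ψ (Φ.clock s a) (Φ.clock s b) = S.action φ a b := by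
  rw [action, action, ← Φ.clock_image_Icc]
  refine congrArg₂ (· + ·) ?_ (Finset.sum_congr rfl fun i _ => ?_)
  · rw [← hS.loc s J hJ φ ψ hφ hψ h.transforms _ (isCompact_univ.prod isCompact_Icc)
      (prod_mono_right hab)]
    exact congrArg _ (h.image_prod hab).symm
  · obtain ⟨K, hK, hKS⟩ := hS.inter i
    rw [← hKS s J hJ φ ψ hφ hψ h.transforms _ (isCompact_univ.prod isCompact_Icc)
      (prod_mono_right hab)]
    refine congrArg _ (image_univ_prod_of_surjective
      (k := fun x t => K s x t ((S.inter i).legVals φ x t)) fun t ht x => ?_).symm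
    let w := (S.inter i).legVals ψ x (Φ.clock s t)
    refine ⟨K (-s) x (Φ.clock s t) w, ?_⟩
    have hlegs : (S.inter i).legVals φ (K (-s) x (Φ.clock s t) w) t =
        fun j => Φ.fiber (-s) ((S.inter i).legs j x) (Φ.clock s t) (w j) := funext fun j => by
      rw [Interaction.legVals, hK.legs]
      exact h.val_base_neg (hab ht) _
    have hinv := hK.add s (-s) x (Φ.clock s t) w
    rw [add_neg_cancel, hK.zero, Φ.clock_neg_clock, ← hlegs] at hinv
    exact hinv.symm

end IsSymmetry

end Model

end SymmetryTransforms

section Noether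

variable {C : Type w} {M : HaarLieGroup.{u}}

/-- The product of a function of the clock variable with a field multiplet; for compactly supported
functions these are the variations that test the equations of motion. -/
def clockSMul (χ : ℝ → ℝ) (δ : Field C M) : Field C M := fun c g t => χ t • δ c g t

lemma Smooth.clockSMul {δ : Field C M} (hδ : Smooth δ) {χ : ℝ → ℝ} (hχ : ContDiff ℝ ∞ χ) :
    Smooth (clockSMul χ δ) := fun c =>
  (hχ.contMDiff.comp contMDiff_snd).smul (hδ c)

lemma jetVariation_clockSMul {δ : Field C M} (hδ : Smooth δ) {χ : ℝ → ℝ} (hχ : ContDiff ℝ ∞ χ)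
    (g : M) (t : ℝ) :
    jetVariation (clockSMul χ δ) g t =
      χ t • jetVariation δ g t + deriv χ t • (0, 0, 0, val δ g t) := by
  have hleft : ∀ c, leftGrad (fun g => clockSMul χ δ c g t) g =
      χ t • leftGrad (fun g => δ c g t) g := fun c => by
    rw [leftGrad_eq_fderiv ((hδ.clockSMul hχ).contMDiff_slice c t),
      leftGrad_eq_fderiv (hδ.contMDiff_slice c t)]
    exact congrFun (fderiv_const_smul_field (χ t)
      (f := fun y => δ c (g * (extChartAt M.I (1 : M)).symm y) t)) _
  refine Prod.ext ?_ (Prod.ext (funext fun c => ?_) (Prod.ext (funext fun c => ?_)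
    (funext fun c => ?_)))
  · change (0 : ℝ) = χ t • (0 : ℝ) + deriv χ t • (0 : ℝ)
    simp
  · change χ t • δ c g t = χ t • δ c g t + deriv χ t • (0 : ℂ)
    simp
  · exact (hleft c).trans (((congrArg _ (smul_zero (deriv χ t))).trans (add_zero _)).symm)
  · change deriv (fun r => χ r • δ c g r) t = χ t • clockDeriv δ g t c + deriv χ t • δ c g t
    exact ((hχ.differentiable (by simp) t).hasDerivAt.smul (hδ.hasDerivAt c g t)).deriv

lemma smoothFamily_line {φ η : Field C M} (hφ : Smooth φ) (hη : Smooth η) :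
    SmoothFamily fun (s : ℝ) c g t => φ c g t + (s : ℂ) * η c g t := fun c => by
  simp only [← Complex.real_smul]
  exact (hφ.const_family c).add (contMDiff_fst.smul (hη.const_family c))

lemma variation_line (φ η : Field C M) (s : ℝ) :
    variation (fun (s : ℝ) c g t => φ c g t + (s : ℂ) * η c g t) s = η := by
  funext c g t
  have h := ((Complex.ofRealCLM.hasDerivAt (x := s)).mul_const (η c g t)).const_add (φ c g t)
  simpa [variation] using h.deriv

namespace Model

variable [Fintype C] {S : Model C M} {Φ : PointFlow C M} {φ δ η : Field C M}

variable (S) in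
lemma sliceVar_clockSMul (hφ : Smooth φ) (hδ : Smooth δ) {χ : ℝ → ℝ} (hχ : ContDiff ℝ ∞ χ)
    (t : ℝ) :
    S.sliceVar φ (clockSMul χ δ) t =
      χ t * S.sliceVar φ δ t + deriv χ t * S.momentumPairing φ δ t := by
  have hloc : ∀ g, fderiv ℝ (S.locLagrangian g) (jet φ g t) (jetVariation (clockSMul χ δ) g t) =
      χ t * fderiv ℝ (S.locLagrangian g) (jet φ g t) (jetVariation δ g t) +
        deriv χ t * S.momentumForm g (jet φ g t) (val δ g t) := fun g => by
    rw [jetVariation_clockSMul hδ hχ, map_add, map_smul, map_smul, momentumForm_apply,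
      smul_eq_mul, smul_eq_mul]
  have hinter : ∀ i x, fderiv ℝ ((S.inter i).lagrangian x) (t, (S.inter i).legVals φ x t)
      (0, (S.inter i).legVals (clockSMul χ δ) x t) =
        χ t * fderiv ℝ ((S.inter i).lagrangian x) (t, (S.inter i).legVals φ x t)
          (0, (S.inter i).legVals δ x t) := fun i x => by
    rw [← smul_eq_mul, ← map_smul, Prod.smul_mk, smul_zero]
    rfl
  have hslice : Continuous fun g : M => (g, t) := by fun_prop
  have hfderiv : Continuous fun g =>
      fderiv ℝ (S.locLagrangian g) (jet φ g t) (jetVariation δ g t) :=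
    ((continuous_fderiv_fibre S.locLagrangian_contMDiff_one).comp
      (continuous_id.prodMk (hφ.continuous_jet.comp hslice))).clm_apply
        (continuous_const.prodMk (hδ.continuous_jet.comp hslice).snd)
  have hmomentum := S.continuous_momentumForm_apply hφ t (v := fun g => val δ g t)
    (hδ.contMDiff_val.continuous.comp hslice)
  simp only [sliceVar, hloc, hinter, integral_const_mul, ← Finset.mul_sum]
  rw [integral_add
    ((hfderiv.integrable_of_hasCompactSupport (.of_compactSpace _)).const_mul _)
    ((hmomentum.integrable_of_hasCompactSupport (.of_compactSpace _)).const_mul _),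
    integral_const_mul, integral_const_mul, momentumPairing]
  ring

variable (S) in
lemma continuous_sliceVar_apply (hφ : Smooth φ) (hδ : Smooth δ) : Continuous (S.sliceVar φ δ) :=
  (S.continuous_sliceVar hφ.const_family hδ.const_family).comp (Continuous.prodMk_right (0 : ℝ))

variable (S) in
lemma sliceVar_congr (φ : Field C M) {δ δ' : Field C M} {t : ℝ}
    (h : ∀ᶠ r in 𝓝 t, ∀ c g, δ c g r = δ' c g r) : S.sliceVar φ δ t = S.sliceVar φ δ' t := by
  have hjet : ∀ g, jetVariation δ g t = jetVariation δ' g t := fun g => by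
    have := jet_snd_add_eq (s := 0) (ψ := δ) (φ := δ') (t := t) (by simpa only [add_zero] using h) g
    rw [add_zero] at this
    rw [jetVariation, this, jetVariation]
  have hlegs : ∀ i x, (S.inter i).legVals δ x t = (S.inter i).legVals δ' x t := fun i x =>
    funext fun j => funext fun c => h.self_of_nhds c _
  simp only [sliceVar, hjet, hlegs]

lemma OnShell.intervalIntegral_sliceVar_eq_zero (hφ : S.OnShell φ) (hη : S.Admissible η) {a b : ℝ}
    (hab : a < b) (hsupp : ∀ c g, ∀ t ∉ Ioo a b, η c g t = 0) :
    ∫ t in a..b, S.sliceVar φ η t = 0 := by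
  have h := S.hasDerivAt_action (smoothFamily_line hφ.1.1 hη.1) hab.le 0
  simp only [variation_line, Complex.ofReal_zero, zero_mul, add_zero] at h
  exact h.unique (hφ.2 a b hab η hη hsupp)

lemma OnShell.hasDerivAt_momentumPairing (hφ : S.OnShell φ) (hδ : S.Admissible δ) (t : ℝ) :
    HasDerivAt (S.momentumPairing φ δ) (S.sliceVar φ δ t) t := by
  refine hasDerivAt_of_integral_smul_add_deriv_smul_eq_zero
    (S.continuous_momentumPairing hφ.1.1 hδ.1) (S.continuous_sliceVar_apply hφ.1.1 hδ.1)
    (fun χ hχ hχs => ?_) t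
  obtain ⟨R, hR0, hR⟩ := hχs.isCompact.isBounded.subset_ball_lt 0 0
  rw [Real.ball_eq_Ioo, zero_sub, zero_add] at hR
  have hadm : S.Admissible (clockSMul χ δ) := ⟨hδ.1.clockSMul hχ, fun k hk c g t => by
    simp only [clockSMul, hδ.2 k hk]⟩
  have hzero := hφ.intervalIntegral_sliceVar_eq_zero hadm (neg_lt_self hR0) fun c g t ht => by
    rw [clockSMul, image_eq_zero_of_notMem_tsupport fun h => ht (hR h), zero_smul]
  simp only [S.sliceVar_clockSMul hφ.1.1 hδ.1 hχ] at hzero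
  rw [← hzero]
  refine (intervalIntegral.integral_eq_integral_of_support_subset fun t ht => ?_).symm
  by_contra hout
  have hχt : t ∉ tsupport χ := fun h => hout (Ioo_subset_Ioc_self (hR h))
  exact ht (by simp [image_eq_zero_of_notMem_tsupport hχt,
    image_eq_zero_of_notMem_tsupport fun h => hχt (tsupport_deriv_subset h)])

namespace IsSymmetry

lemma intervalIntegral_sliceVar_char (hS : S.IsSymmetry Φ) (hφ : S.Admissible φ) {a b : ℝ}
    (hab : a ≤ b) :
    ∫ t in a..b, S.sliceVar φ (Φ.char φ) t =
      S.sliceAction φ a * Φ.clockGen a - S.sliceAction φ b * Φ.clockGen b := by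
  obtain ⟨R, haR, hbR⟩ : ∃ R, -R < a ∧ b < R :=
    ⟨max (-a) b + 1, by linarith [le_max_left (-a) b], by linarith [le_max_right (-a) b]⟩
  have hsub : Icc a b ⊆ Ioo (-R) R := Icc_subset_Ioo haR hbR
  obtain ⟨Ψ, hΨ, rfl, hev⟩ := hS.exists_smoothFamily_admissible hφ R
  have hleibniz := hasDerivAt_intervalIntegral_leibniz (f := fun s t => S.sliceAction (Ψ s) t)
    (f' := fun s t => S.sliceVar (Ψ s) (variation Ψ s) t) (S.continuous_sliceAction hΨ)
    (S.continuous_sliceVar hΨ hΨ.variation) (S.hasDerivAt_sliceAction hΨ)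
    (Φ.hasDerivAt_clock a) (Φ.hasDerivAt_clock b)
  have hconst : ∀ᶠ s in 𝓝 (0 : ℝ), (∫ t in Φ.clock s a..Φ.clock s b, S.sliceAction (Ψ s) t) =
      S.action (Ψ 0) a b := by
    filter_upwards [hev] with s hs
    rw [← S.action_eq_intervalIntegral_sliceAction hs.1.1 ((Φ.clock_strictMono s).monotone hab)]
    exact hS.action_eq isOpen_Ioo hφ hs.1 hs.2 hsub
  have hzero := hleibniz.unique
    ((hasDerivAt_const (0 : ℝ) (S.action (Ψ 0) a b)).congr_of_eventuallyEq hconst)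
  have hchar : ∀ t ∈ Ioo (-R) R,
      S.sliceVar (Ψ 0) (variation Ψ 0) t = S.sliceVar (Ψ 0) (Φ.char (Ψ 0)) t := fun t ht =>
    S.sliceVar_congr _ <| (isOpen_Ioo.eventually_mem ht).mono fun r hr c g =>
      Φ.variation_eq_char hΨ rfl (hev.mono fun s hs => hs.2.transforms) c g hr
  have hint : ∫ t in a..b, S.sliceVar (Ψ 0) (variation Ψ 0) t =
      ∫ t in a..b, S.sliceVar (Ψ 0) (Φ.char (Ψ 0)) t :=
    intervalIntegral.integral_congr fun t ht => hchar t (hsub (uIcc_of_le hab ▸ ht))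
  simp only [Φ.clock_zero, smul_eq_mul] at hzero
  rw [← hint]
  linarith

lemma hasDerivAt_sliceAction_mul_clockGen (hS : S.IsSymmetry Φ) (hφ : S.Admissible φ) (t : ℝ) :
    HasDerivAt (fun r => S.sliceAction φ r * Φ.clockGen r) (-S.sliceVar φ (Φ.char φ) t) t := by
  have hint : ∀ b, ∫ r in t..b, S.sliceVar φ (Φ.char φ) r =
      S.sliceAction φ t * Φ.clockGen t - S.sliceAction φ b * Φ.clockGen b := fun b => by
    rcases le_total t b with h | h
    · exact hS.intervalIntegral_sliceVar_char hφ h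
    · rw [intervalIntegral.integral_symm, hS.intervalIntegral_sliceVar_char hφ h, neg_sub]
  have hftc := ((S.continuous_sliceVar_apply hφ.1
    (hS.admissible_char hφ).1).integral_hasStrictDerivAt t t).hasDerivAt
  simp only [hint] at hftc
  simpa using hftc.const_sub (S.sliceAction φ t * Φ.clockGen t)

theorem hasDerivAt_charge (hS : S.IsSymmetry Φ) (hφ : S.OnShell φ) (t : ℝ) :
    HasDerivAt (S.charge Φ φ) 0 t := by
  rw [funext (S.charge_eq_momentumPairing Φ φ)]
  simpa using ((hS.hasDerivAt_sliceAction_mul_clockGen hφ.1 t).add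
    (hφ.hasDerivAt_momentumPairing (hS.admissible_char hφ.1) t)).ofReal_comp

end IsSymmetry

end Model

end Noether

end GFT

end

theorem mainTheorem7 {C : Type w} [Fintype C] {M : HaarLieGroup.{u}} (S : GFT.Model C M) :
    -- every symmetry yields a charge that is conserved on shell
    (∀ Φ : GFT.PointFlow C M, S.IsSymmetry Φ → ∀ φ, S.OnShell φ →
      ∀ t, HasDerivAt (S.charge Φ φ) 0 t) ∧
    -- `U(1)` symmetries
    (∀ (θ : C → ℝ) (φ : GFT.Field C M), GFT.Smooth φ → ∀ t,
      (∀ c g, (GFT.phaseFlow M θ).char φ c g t = Complex.I * θ c * φ c g t) ∧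
      S.charge (GFT.phaseFlow M θ) φ t =
        Complex.I * ∑ c, (θ c : ℂ) * ∫ g, (φ c g t * S.mom φ c g t -
          (starRingEnd ℂ) (φ c g t) * S.momBar φ c g t) ∂M.haar) ∧
    -- transformations of the base manifold `M`
    (∀ Φ : GFT.PointFlow C M, Φ.IsPureBase → ∀ φ : GFT.Field C M, GFT.Smooth φ → ∀ t,
      (∀ c g, Φ.char φ c g t = -Φ.lieDeriv φ (φ c) g t) ∧
      S.charge Φ φ t =
        -(∫ g, ∑ c, S.mom φ c g t * Φ.lieDeriv φ (φ c) g t ∂M.haar) -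
          ∫ g, ∑ c, S.momBar φ c g t *
            Φ.lieDeriv φ (fun h r => (starRingEnd ℂ) (φ c h r)) g t ∂M.haar) ∧
    -- in particular `SU(2)` symmetries, for `M = SU(2)^n`
    (∀ (n : ℕ) (e : M ≃* (Fin n → Matrix.specialUnitaryGroup (Fin 2) ℂ))
      (A B : Fin n → Matrix (Fin 2) (Fin 2) ℂ) (Φ : GFT.PointFlow C M),
      Φ.IsSU2Translation e A B → ∀ φ : GFT.Field C M, GFT.Smooth φ → ∀ t,
      (∀ c g, Φ.char φ c g t = -Φ.lieDeriv φ (φ c) g t) ∧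
      S.charge Φ φ t =
        -(∫ g, ∑ c, S.mom φ c g t * Φ.lieDeriv φ (φ c) g t ∂M.haar) -
          ∫ g, ∑ c, S.momBar φ c g t *
            Φ.lieDeriv φ (fun h r => (starRingEnd ℂ) (φ c h r)) g t ∂M.haar) ∧
    -- translations of the clock variable: when they are symmetries, the form of the charge
    (S.ClockIndependent → S.IsSymmetry (GFT.translationFlow C M)) ∧
    (∀ φ : GFT.Field C M, GFT.Smooth φ → ∀ t,
      S.charge (GFT.translationFlow C M) φ t =
        -(∫ g, ∑ c, (S.mom φ c g t * deriv (fun r => φ c g r) t +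
          S.momBar φ c g t * deriv (fun r => (starRingEnd ℂ) (φ c g r)) t) ∂M.haar) +
        (S.sliceAction φ t : ℂ)) ∧
    -- the charge is the Legendre transform of the slice Lagrangian up to sign: `Π` is the fibre
    -- derivative of the slice Lagrangian with respect to the velocity
    (∀ φ : GFT.Field C M, GFT.Smooth φ → ∀ t, ∀ v : C → M → ℂ, (∀ c, Continuous (v c)) →
      HasDerivAt
        (fun s : ℝ => ((S.sliceLagrangian t (GFT.slice φ t)
          (fun c g => GFT.sliceVel φ t c g + (s : ℂ) * v c g) : ℝ) : ℂ))
        (∫ g, ∑ c, (S.mom φ c g t * v c g +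
          S.momBar φ c g t * (starRingEnd ℂ) (v c g)) ∂M.haar) 0) := by
  exact ⟨fun _ hΦ _ hφ t => hΦ.hasDerivAt_charge hφ t,
    fun θ φ hφ t => ⟨fun c g => GFT.phaseFlow_char θ φ c g t, S.charge_phaseFlow θ hφ t⟩,
    fun _ hΦ φ hφ t => ⟨fun c g => hΦ.char_eq φ c g t, S.charge_of_isPureBase hΦ hφ t⟩,
    fun _ _ _ _ _ hΦ φ hφ t =>
      ⟨fun c g => hΦ.2.1.char_eq φ c g t, S.charge_of_isPureBase hΦ.2.1 hφ t⟩,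
    S.isSymmetry_translationFlow, fun φ _ t => S.charge_translationFlow φ t,
    fun _ hφ t _ hv => S.hasDerivAt_sliceLagrangian hφ t hv⟩
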